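/- **Setting.** Let $N\ge 1$. A weight function is a continuous increasing function $\omega:[0,\infty)\to[0,\infty)$ such that ($\alpha$) there is $K\ge 1$ with $\omega(2t)\le K(1+\omega(t))$ for all $t\ge0$; ($\beta$) $\omega(t)=o(t)$ as $t\to\infty$; ($\gamma$) there are $a\in\mathbb R$, $b>0$ with $\omega(t)\ge a+b\log(1+t)$ for all $t\ge 0$; ($\delta$) $t\mapsto\omega(e^t)$ is convex. Fix such $\omega$ and constants $K,a,b$. For $x\in\mathbb R^M$ put $\omega(x)=\omega(|x|)$, with the Euclidean norm. Let $\hat f(\xi)=\int e^{-ix\xi}f(x)\,dx$. The space $\mathcal S_\omega(\mathbb R^M)$ consists of all $f\in L^1(\mathbb R^M)$ with $f,\hat f\in C^\infty$ and $\|e^{\lambda\omega}\partial^\alpha f\|_\infty<\infty$, $\|e^{\lambda\omega}\partial^\alpha\hat f\|_\infty<\infty$ for all $\lambda>0$ and all multi-indices $\alpha$; $\mathcal S'_\omega(\mathbb R^M)$ is its dual, and $\mathcal S(\mathbb R^N)$ is the Schwartz space. For $x,\xi\in\mathbb R^N$ set $$V_gf(x,\xi)=\int_{\mathbb R^N} f(y)\overline{g(y-x)}e^{-iy\xi}dy,\qquad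 Sp_gf=|V_gf|^2,\qquad Rf(x,\xi)=e^{-ix\xi}f(x)\overline{\hat f(\xi)},$$ $$\mathrm{Wig}(f)(x,\xi)=\int_{\mathbb R^N} e^{-it\xi}f\left(x+\tfrac t2\right)\overline{f\left(x-\tfrac t2\right)}\,dt,\qquad Q_\sigma f=\sigma\star \mathrm{Wig}(f)\quad(\sigma\in\mathcal S'_\omega(\mathbb R^{2N})).$$ Here $\|e^{\nu\omega}\sigma\|_q<\infty$ means that $\sigma$ is given by a measurable function with this property. For $p\in[1,\infty]$, $p'$ is the conjugate exponent, and $(2p)'$ is that of $2p$ ($(2p)'=1$ if $p=\infty$). Norms of functions on $\mathbb R^N$ or $\mathbb R^{2N}$ are taken over that space and have values in $[0,\infty]$, with $0\cdot\infty=0$; in $\|e^{-\mu\omega}\|_q$ below, $\omega$ is taken on $\mathbb R^{2N}$. **Statement.** Let $1\le p\le\infty$. (i) Let $\sigma\in\mathcal S'_\omega(\mathbb R^{2N})$ satisfy $\|e^{\nu\omega}\sigma\|_{p'}<\infty$ for every $\nu\ge0$. Then for every $\lambda\ge0$ and $f\in\mathcal S_\omega(\mathbb R^N)$ $$\|e^{\lambda\omega}Q_\sigma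 f\|_\infty\le e^{K\lambda}\|e^{K\lambda\omega}\sigma\|_{p'}\,\|e^{K\lambda\omega}\mathrm{Wig}(f)\|_p .$$ (ii) Let $\sigma\in\mathcal S'_\omega(\mathbb R^{2N})$ satisfy $\|e^{\nu\omega}\sigma\|_1<\infty$ for every $\nu\ge0$. Then for every $\lambda\ge0$ and $f\in\mathcal S_\omega(\mathbb R^N)$ $$\|e^{\lambda\omega}Q_\sigma f\|_\infty^2\le \left(\tfrac{4}{2\pi}\right)^N e^{K(2+K+2K^2)\lambda}\|e^{K\lambda\omega}\sigma\|_1^2\;\|e^{4K^3\lambda\omega}Rf\|_p\,\|e^{4K^3\lambda\omega}Rf\|_{p'} .$$ (iii) Let $\sigma$ be as in (ii) and $g\in\mathcal S(\mathbb R^N)$, $g\ne0$. Then for every $\lambda\ge0$, $\mu>\frac{2N}{b}\left(K^2+\frac{2}{(2p)'}\right)$ and $f\in\mathcal S_\omega(\mathbb R^N)$ $$\|e^{\lambda\omega}Q_\sigma f\|_\infty\le D_{\lambda,\mu}\,\|e^{(8K^5\lambda+\mu)\omega}Sp_gf\|_p,\qquad D_{\lambda,\mu}=e^{K\lambda}\,D^{(6)}_{\lambda,\mu}\,\|e^{K\lambda\omega}\sigma\|_1,$$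 where, with $\tau=\frac12$, $$D^{(6)}_{\lambda,\mu}=\frac{e^{\frac K2(1+2K)\lambda}}{(2\pi)^{\frac52N}(\tau-\tau^2)^{\frac N2}\|g\|_2^4}\inf_{\mu',\mu''}\Big[e^{K(1+2K)(4K^2\lambda+\mu')}\|e^{K^2(4K^2\lambda+\mu')\omega}g\|_\infty\|e^{K^2(4K^2\lambda+\mu')\omega}\hat g\|_\infty\|e^{-\mu'\omega}\|_2\|e^{-\mu''\omega}\|_{(2p)'}^2\Big],$$ the infimum being over all real $\mu'>\frac Nb$, $\mu''>\frac{2N}{b(2p)'}$ with $2(K^2\mu'+\mu'')=\mu$. Moreover, $D_{\lambda,\mu}<\infty$ if $g\in\mathcal S_\omega(\mathbb R^N)$. -/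

import Mathlib

open MeasureTheory Filter Asymptotics
open scoped ENNReal NNReal SchwartzMap

noncomputable section

/-- `ω : [0,∞) → [0,∞)` is a weight function. Only the values of `ω` on `[0,∞)` matter. The constant
`K` of condition (α) and the constants `a`, `b` of condition (γ) are recorded, since they enter the
estimates. -/
structure IsWeightFunction (ω : ℝ → ℝ) (K a b : ℝ) : Prop where
  continuousOn : ContinuousOn ω (Set.Ici 0)
  monotoneOn : MonotoneOn ω (Set.Ici 0)
  nonneg : ∀ t, 0 ≤ t → 0 ≤ ω t
  one_le_K : 1 ≤ K
  alpha : ∀ t, 0 ≤ t → ω (2 * t) ≤ K * (1 + ω t)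
  beta : ω =o[atTop] (fun t : ℝ => t)
  b_pos : 0 < b
  gamma : ∀ t, 0 ≤ t → a + b * Real.log (1 + t) ≤ ω t
  delta : ConvexOn ℝ Set.univ (fun t : ℝ => ω (Real.exp t))

section General

variable {V : Type*} [NormedAddCommGroup V] [InnerProductSpace ℝ V] [FiniteDimensional ℝ V]
  [MeasurableSpace V] [BorelSpace V]

/-- The Fourier transform with the normalization `f̂(ξ) = ∫ e^{-i x·ξ} f(x) dx`. -/
def fourierHat (f : V → ℂ) (ξ : V) : ℂ :=
  ∫ x, Complex.exp (-(Complex.I * (inner ℝ x ξ : ℝ))) * f x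

/-- `‖e^{lω} F‖_p`, where `ω(x) = ω(|x|)` with the Euclidean norm `|x|`. -/
def weightedNorm {G : Type*} [NormedAddCommGroup G] [NormedSpace ℝ G]
    (ω : ℝ → ℝ) (p : ℝ≥0∞) (l : ℝ) (F : V → G) : ℝ≥0∞ :=
  eLpNorm (fun x => Real.exp (l * ω ‖x‖) • F x) p volume

/-- `sup_x e^{lω(x)} |D^n f(x)|`, with the operator norm of the `n`-th derivative, which is equivalent
to the maximum of all the partial derivatives of order `n`. -/
def derivSup (ω : ℝ → ℝ) (l : ℝ) (n : ℕ) (f : V → ℂ) : ℝ≥0∞ :=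
  ⨆ x, ENNReal.ofReal (Real.exp (l * ω ‖x‖) * ‖iteratedFDeriv ℝ n f x‖)

theorem derivSup_zero (ω : ℝ → ℝ) (l : ℝ) (n : ℕ) : derivSup ω l n (0 : V → ℂ) = 0 := by
  have h : iteratedFDeriv ℝ n (0 : V → ℂ) = 0 := by
    rw [Pi.zero_def, iteratedFDeriv_fun_zero]
  simp [derivSup, h]

theorem derivSup_add_le (ω : ℝ → ℝ) (l : ℝ) (n : ℕ) {f g : V → ℂ} (hf : ContDiff ℝ (⊤ : ℕ∞) f)
    (hg : ContDiff ℝ (⊤ : ℕ∞) g) :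
    derivSup ω l n (f + g) ≤ derivSup ω l n f + derivSup ω l n g := by
  refine iSup_le fun x => ?_
  have hn : ((n : ℕ∞) : WithTop ℕ∞) ≤ ((⊤ : ℕ∞) : WithTop ℕ∞) := by
    exact_mod_cast le_top
  rw [iteratedFDeriv_add_apply ((hf.of_le hn).contDiffAt) ((hg.of_le hn).contDiffAt)]
  refine le_trans (ENNReal.ofReal_le_ofReal
    (mul_le_mul_of_nonneg_left (norm_add_le _ _) (Real.exp_pos _).le)) ?_
  rw [mul_add, ENNReal.ofReal_add (by positivity) (by positivity)]
  exact add_le_add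
    (le_iSup (fun x => ENNReal.ofReal (Real.exp (l * ω ‖x‖) * ‖iteratedFDeriv ℝ n f x‖)) x)
    (le_iSup (fun x => ENNReal.ofReal (Real.exp (l * ω ‖x‖) * ‖iteratedFDeriv ℝ n g x‖)) x)

theorem derivSup_smul_le (ω : ℝ → ℝ) (l : ℝ) (n : ℕ) (c : ℂ) {f : V → ℂ}
    (hf : ContDiff ℝ (⊤ : ℕ∞) f) :
    derivSup ω l n (c • f) ≤ ENNReal.ofReal ‖c‖ * derivSup ω l n f := by
  refine iSup_le fun x => ?_
  have hn : ((n : ℕ∞) : WithTop ℕ∞) ≤ ((⊤ : ℕ∞) : WithTop ℕ∞) := by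
    exact_mod_cast le_top
  rw [iteratedFDeriv_const_smul_apply ((hf.of_le hn).contDiffAt), norm_smul, mul_left_comm,
    ENNReal.ofReal_mul (norm_nonneg c)]
  gcongr
  exact le_iSup (fun x => ENNReal.ofReal (Real.exp (l * ω ‖x‖) * ‖iteratedFDeriv ℝ n f x‖)) x

theorem integrable_fourier_kernel_mul {f : V → ℂ} (hf : Integrable f volume) (ξ : V) :
    Integrable (fun x => Complex.exp (-(Complex.I * (inner ℝ x ξ : ℝ))) * f x) volume := by
  refine hf.bdd_mul (c := 1) (by fun_prop) (Eventually.of_forall fun x => ?_)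
  rw [← mul_neg, ← Complex.ofReal_neg, mul_comm, Complex.norm_exp_ofReal_mul_I]

theorem fourierHat_zero : fourierHat (0 : V → ℂ) = 0 := by
  funext ξ
  simp [fourierHat]

theorem fourierHat_add {f g : V → ℂ} (hf : Integrable f volume) (hg : Integrable g volume) :
    fourierHat (f + g) = fourierHat f + fourierHat g := by
  funext ξ
  simp only [fourierHat, Pi.add_apply, mul_add]
  exact integral_add (integrable_fourier_kernel_mul hf ξ) (integrable_fourier_kernel_mul hg ξ)

theorem fourierHat_smul (c : ℂ) (f : V → ℂ) : fourierHat (c • f) = c • fourierHat f := by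
  funext ξ
  simp only [fourierHat, Pi.smul_apply, smul_eq_mul, ← integral_const_mul]
  congr 1
  funext x
  ring

variable (V) in
/-- The space `𝒮_ω(V)` of `ω`-ultradifferentiable rapidly decreasing functions of Beurling type:
`f ∈ L¹`, `f, f̂ ∈ C^∞`, and `‖e^{lω} ∂^α f‖_∞ < ∞`, `‖e^{lω} ∂^α f̂‖_∞ < ∞` for all `l > 0` and all
`α`. -/
def ultraSchwartz (ω : ℝ → ℝ) : Submodule ℂ (V → ℂ) where
  carrier := {f | Integrable f volume ∧ ContDiff ℝ (⊤ : ℕ∞) f ∧ ContDiff ℝ (⊤ : ℕ∞) (fourierHat f) ∧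
    ∀ l : ℝ, 0 < l → ∀ n : ℕ, derivSup ω l n f < ∞ ∧ derivSup ω l n (fourierHat f) < ∞}
  zero_mem' := by
    refine ⟨integrable_zero _ _ _, contDiff_const, ?_, fun l _ n => ⟨?_, ?_⟩⟩
    · rw [fourierHat_zero]
      exact contDiff_const
    · simp [derivSup_zero]
    · simp [fourierHat_zero, derivSup_zero]
  add_mem' := by
    rintro f g ⟨hf, hf1, hf2, hf3⟩ ⟨hg, hg1, hg2, hg3⟩
    refine ⟨hf.add hg, hf1.add hg1, ?_, fun l hl n => ⟨?_, ?_⟩⟩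
    · rw [fourierHat_add hf hg]
      exact hf2.add hg2
    · exact (derivSup_add_le ω l n hf1 hg1).trans_lt
        (ENNReal.add_lt_top.2 ⟨(hf3 l hl n).1, (hg3 l hl n).1⟩)
    · rw [fourierHat_add hf hg]
      exact (derivSup_add_le ω l n hf2 hg2).trans_lt
        (ENNReal.add_lt_top.2 ⟨(hf3 l hl n).2, (hg3 l hl n).2⟩)
  smul_mem' := by
    rintro c f ⟨hf, hf1, hf2, hf3⟩
    refine ⟨hf.smul c, contDiff_const.smul hf1, ?_, fun l hl n => ⟨?_, ?_⟩⟩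
    · rw [fourierHat_smul]
      exact contDiff_const.smul hf2
    · exact (derivSup_smul_le ω l n c hf1).trans_lt
        (ENNReal.mul_lt_top ENNReal.ofReal_lt_top (hf3 l hl n).1)
    · rw [fourierHat_smul]
      exact (derivSup_smul_le ω l n c hf2).trans_lt
        (ENNReal.mul_lt_top ENNReal.ofReal_lt_top (hf3 l hl n).2)

variable (V) in
/-- The dual space `𝒮'_ω(V)`: linear functionals on `𝒮_ω(V)` that are continuous, that is, bounded by
a multiple of finitely many of the seminorms defining the topology of `𝒮_ω(V)` (these increase with
`l`, so that one `l` is enough). -/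
structure UltraDistribution (ω : ℝ → ℝ) where
  toLinearMap : ultraSchwartz V ω →ₗ[ℂ] ℂ
  continuous' : ∃ (C : ℝ≥0) (l : ℝ) (n : ℕ), 0 < l ∧ ∀ φ : ultraSchwartz V ω,
    ‖toLinearMap φ‖ₑ ≤ C * ∑ k ∈ Finset.range (n + 1),
      (derivSup ω l k (φ : V → ℂ) + derivSup ω l k (fourierHat (φ : V → ℂ)))

namespace UltraDistribution

variable {ω : ℝ → ℝ}

open Classical in
/-- The (bilinear) action of `σ ∈ 𝒮'_ω(V)` on `φ ∈ 𝒮_ω(V)`; the value for functions `φ` outside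
`𝒮_ω(V)` is irrelevant. -/
def pair (σ : UltraDistribution V ω) (φ : V → ℂ) : ℂ :=
  if h : φ ∈ ultraSchwartz V ω then σ.toLinearMap ⟨φ, h⟩ else 0

/-- The convolution of `σ ∈ 𝒮'_ω(V)` and `φ ∈ 𝒮_ω(V)`: `(σ ⋆ φ)(z) = ⟨σ, φ(z - ·)⟩`. -/
def conv (σ : UltraDistribution V ω) (φ : V → ℂ) (z : V) : ℂ :=
  σ.pair (fun w => φ (z - w))

/-- `σ ∈ 𝒮'_ω(V)` is (the functional of integration against) the measurable function `s`. -/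
def IsFunction (σ : UltraDistribution V ω) (s : V → ℂ) : Prop :=
  AEStronglyMeasurable s volume ∧ ∀ φ : ultraSchwartz V ω,
    Integrable (fun x => s x * (φ : V → ℂ) x) volume ∧
      σ.toLinearMap φ = ∫ x, s x * (φ : V → ℂ) x

end UltraDistribution

end General

/-- `ℝ^N`. -/
abbrev Space (N : ℕ) : Type := EuclideanSpace ℝ (Fin N)

/-- `ℝ^{2N} = ℝ^N × ℝ^N` with the Euclidean norm `|(x,ξ)| = (|x|² + |ξ|²)^{1/2}`; the points are
`z = (z.fst, z.snd) = (x, ξ)`. -/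
abbrev PhaseSpace (N : ℕ) : Type := WithLp 2 (Space N × Space N)

variable {N : ℕ}

/-- The short-time Fourier transform `V_g f(x,ξ) = ∫ f(y) conj(g(y-x)) e^{-i y·ξ} dy`. -/
def stft (g f : Space N → ℂ) (z : PhaseSpace N) : ℂ :=
  ∫ y, f y * (starRingEnd ℂ) (g (y - z.fst)) * Complex.exp (-(Complex.I * (inner ℝ y z.snd : ℝ)))

/-- The spectrogram `Sp_g f = |V_g f|²`. -/
def spectrogram (g f : Space N → ℂ) (z : PhaseSpace N) : ℝ :=
  ‖stft g f z‖ ^ 2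

/-- The Rihaczek form `Rf(x,ξ) = e^{-i x·ξ} f(x) conj(f̂(ξ))`. -/
def rihaczek (f : Space N → ℂ) (z : PhaseSpace N) : ℂ :=
  Complex.exp (-(Complex.I * (inner ℝ z.fst z.snd : ℝ))) * f z.fst *
    (starRingEnd ℂ) (fourierHat f z.snd)

/-- The classical Wigner transform `Wig(f)(x,ξ) = ∫ e^{-i t·ξ} f(x+t/2) conj(f(x-t/2)) dt`. -/
def wigner (f : Space N → ℂ) (z : PhaseSpace N) : ℂ :=
  ∫ t : Space N, Complex.exp (-(Complex.I * (inner ℝ t z.snd : ℝ))) *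
    f (z.fst + (1 / 2 : ℝ) • t) * (starRingEnd ℂ) (f (z.fst - (1 / 2 : ℝ) • t))

/-- The representation `Q_σ f = σ ⋆ Wig(f)` in the Cohen class with kernel `σ ∈ 𝒮'_ω(ℝ^{2N})`.
For a weight function `ω` and `f ∈ 𝒮_ω(ℝ^N)`, the functions `Wig(f)` and `Wig(f)(z - ·)` belong to
`𝒮_ω(ℝ^{2N})`, so that `σ` acts on them. -/
def cohen {ω : ℝ → ℝ} (σ : UltraDistribution (PhaseSpace N) ω) (f : Space N → ℂ) :
    PhaseSpace N → ℂ :=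
  σ.conv (wigner f)

/-- The number `(2p)'`, for `p ∈ [1,∞]`. -/
def twoPConj (p : ℝ≥0∞) : ℝ≥0∞ := ENNReal.conjExponent (2 * p)

/-- The constant `e^{Kl} ‖e^{Klω} σ‖_{p'}` in the estimate of `Q_σ f` by `Wig(f)`. -/
def constWigner (ω : ℝ → ℝ) (K : ℝ) (p' : ℝ≥0∞) (s : PhaseSpace N → ℂ) (l : ℝ) : ℝ≥0∞ :=
  ENNReal.ofReal (Real.exp (K * l)) * weightedNorm ω p' (K * l) s

/-- The constant `(4/2π)^N e^{K(2+K+2K²)l} ‖e^{Klω} σ‖_1²` in the estimate of `Q_σ f` by `Rf`. -/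
def constRihaczek (ω : ℝ → ℝ) (K : ℝ) (s : PhaseSpace N → ℂ) (l : ℝ) : ℝ≥0∞ :=
  ENNReal.ofReal ((4 / (2 * Real.pi)) ^ N * Real.exp (K * (2 + K + 2 * K ^ 2) * l)) *
    weightedNorm ω 1 (K * l) s ^ 2

/-- The constant in the estimate of the `τ`-Wigner transform by the spectrogram. -/
def constWignerSpectrogram (ω : ℝ → ℝ) (K b : ℝ) (p : ℝ≥0∞) (τ : ℝ) (g : Space N → ℂ) (l μ : ℝ) : ℝ≥0∞ :=
  ENNReal.ofReal (Real.exp (K / 2 * (1 + 2 * K) * l) /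
      ((2 * Real.pi) ^ (5 / 2 * (N : ℝ)) * (τ - τ ^ 2) ^ ((N : ℝ) / 2))) /
    eLpNorm g 2 volume ^ 4 *
  ⨅ (μ₁ : ℝ) (μ₂ : ℝ) (_ : 2 * (K ^ 2 * μ₁ + μ₂) = μ ∧ (N : ℝ) / b < μ₁ ∧
      2 * (N : ℝ) / (b * (twoPConj p).toReal) < μ₂),
    ENNReal.ofReal (Real.exp (K * (1 + 2 * K) * (4 * K ^ 2 * l + μ₁))) *
      weightedNorm ω ∞ (K ^ 2 * (4 * K ^ 2 * l + μ₁)) g *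
      weightedNorm ω ∞ (K ^ 2 * (4 * K ^ 2 * l + μ₁)) (fourierHat g) *
      weightedNorm ω 2 (-μ₁) (fun _ : PhaseSpace N => (1 : ℝ)) *
      weightedNorm ω (twoPConj p) (-μ₂) (fun _ : PhaseSpace N => (1 : ℝ)) ^ 2

/-- The constant in the estimate of `Q_σ f` by `Sp_g f`. -/
def constSpectrogram (ω : ℝ → ℝ) (K b : ℝ) (p : ℝ≥0∞) (s : PhaseSpace N → ℂ) (g : Space N → ℂ)
    (l μ : ℝ) : ℝ≥0∞ :=
  ENNReal.ofReal (Real.exp (K * l)) * constWignerSpectrogram ω K b p (1 / 2) g l μ * weightedNorm ω 1 (K * l) s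

end

/-! The whole argument is a chain of convolution inequalities in which the weight is carried along
by `ω(x) ≤ K(1 + ω(y) + ω(z))` whenever `|x| ≤ |y| + |z|`.

For (i), `Q_σ f` is a genuine convolution integral because `Wig(f)(z - ·)` lies in `𝒮_ω`; a weighted
`L^{p'} × L^p → L^∞` Young inequality then gives the bound (`weightedNorm_cohen_le`).

For (ii), take (i) with exponents `(1, ∞)` and bound `|Wig(f)(x,ξ)|` in two ways: directly by `2^N
(|f| ⋆ |f|)(2x)`, and through Parseval by `2^N (2π)^{-N} (|f̂| ⋆ |f̂|)(2ξ)`. Since `|Rf| = |f| ⊗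
|f̂|`, the product of the two bounds is `(4/2π)^N (|Rf| ⋆ |Rf|)(2z)` (`enorm_crossWigner_sq_le`). As
`z` is the midpoint of `w` and `2z - w`, the weight passes to the two factors without any loss, and
Hölder finishes.

For (iii), use (ii) with `p = 2`, pass from `L²` to `L^∞` at the price of `‖e^{-μ'ω}‖_2`, and
recover `f` and `f̂` from `V_g f` by Fourier inversion: `‖g‖_2² |f|` and `‖g‖_2² |f̂|` are dominated
by partial convolutions of `|V_g f|` with `|g|` and `|ĝ|` (`weightedNorm_top_rihaczekForm_le`).
Hölder with `(2p)'` and `2p` turns the resulting `‖V_g f‖_1²` into `‖V_g f‖_{2p}² = ‖Sp_g f‖_p`.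

That `Wig(f)` belongs to `𝒮_ω(ℝ^{2N})` needs only the decay of `Wig(f)` and of its Fourier
transform, derivatives being recovered by interpolation (`mem_ultraSchwartz_of_rapidDecay`). The
decay of `Wig(f)` comes from the bound in (ii), and its Fourier transform is a rescaled cross-Wigner
transform, to which the same bound applies. -/

section Weights

/-! ### Elementary inequalities for weight functions. -/

namespace IsWeightFunction

variable {ω : ℝ → ℝ} {K a b : ℝ}

theorem K_pos (h : IsWeightFunction ω K a b) : 0 < K := zero_lt_one.trans_le h.one_le_K

/-- Only monotonicity and nonnegativity enter, so no factor `K` appears; midpoint estimates rely on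
this. -/
theorem le_of_le_max (h : IsWeightFunction ω K a b) {r s t : ℝ} (hr : 0 ≤ r) (hs : 0 ≤ s)
    (ht : 0 ≤ t) (hrs : t ≤ max r s) : ω t ≤ ω r + ω s := by
  rcases le_max_iff.1 hrs with h1 | h1
  · linarith [h.monotoneOn ht hr h1, h.nonneg s hs]
  · linarith [h.monotoneOn ht hs h1, h.nonneg r hr]

/-- Since `r + s ≤ 2 max r s`, one use of (α) suffices. Each application costs one factor `K`, which
is where the powers of `K` in the estimates come from. -/
theorem le_of_le_add (h : IsWeightFunction ω K a b) {r s t : ℝ} (hr : 0 ≤ r) (hs : 0 ≤ s)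
    (ht : 0 ≤ t) (hrs : t ≤ r + s) : ω t ≤ K * (1 + (ω r + ω s)) := by
  have hm : 0 ≤ max r s := le_max_of_le_left hr
  have h1 : ω t ≤ ω (2 * max r s) := by
    refine h.monotoneOn ht (by simpa using hm) (hrs.trans ?_)
    linarith [le_max_left r s, le_max_right r s]
  refine h1.trans ((h.alpha _ hm).trans ?_)
  gcongr
  · exact h.K_pos.le
  · exact h.le_of_le_max hr hs hm le_rfl

theorem le_of_le_two_mul (h : IsWeightFunction ω K a b) {r t : ℝ} (hr : 0 ≤ r)
    (ht : 0 ≤ t) (hrt : t ≤ 2 * r) : ω t ≤ K * (1 + ω r) :=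
  (h.monotoneOn ht (by simpa using hr) hrt).trans (h.alpha r hr)

theorem continuous_norm {V : Type*} [SeminormedAddCommGroup V] (h : IsWeightFunction ω K a b) :
    Continuous fun x : V => ω ‖x‖ :=
  h.continuousOn.comp_continuous (by fun_prop) fun x => norm_nonneg x

theorem continuous_exp {V : Type*} [SeminormedAddCommGroup V] (h : IsWeightFunction ω K a b)
    (l : ℝ) : Continuous fun x : V => Real.exp (l * ω ‖x‖) := by
  exact Real.continuous_exp.comp (continuous_const.mul h.continuous_norm)

/-- Condition (γ) makes `e^{-lω}` decay polynomially at rate `l * b`, hence integrable once `l * b`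
exceeds the dimension. -/
theorem exp_neg_le (h : IsWeightFunction ω K a b) {l : ℝ} (hl : 0 ≤ l) {t : ℝ} (ht : 0 ≤ t) :
    Real.exp (-l * ω t) ≤ Real.exp (-l * a) * (1 + t) ^ (-(l * b)) := by
  rw [Real.rpow_def_of_pos (by linarith), ← Real.exp_add]
  refine Real.exp_le_exp.2 ?_
  have := mul_le_mul_of_nonneg_left (h.gamma t ht) hl
  linarith

variable {V : Type*} [NormedAddCommGroup V] [NormedSpace ℝ V] [FiniteDimensional ℝ V]
  [MeasurableSpace V] [BorelSpace V]

theorem integrable_exp_neg (h : IsWeightFunction ω K a b) (μ : Measure V) [μ.IsAddHaarMeasure]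
    {l : ℝ} (hl : 0 ≤ l) (hd : (Module.finrank ℝ V : ℝ) < l * b) :
    Integrable (fun x : V => Real.exp (-l * ω ‖x‖)) μ := by
  refine ((integrable_one_add_norm (μ := μ) hd).const_mul (Real.exp (-l * a))).mono'
    (h.continuous_exp (-l)).aestronglyMeasurable (Eventually.of_forall fun x => ?_)
  rw [Real.norm_eq_abs, abs_of_pos (Real.exp_pos _)]
  exact h.exp_neg_le hl (norm_nonneg x)

theorem pow_le (h : IsWeightFunction ω K a b) (n : ℕ) : ∃ (C l : ℝ), 0 < l ∧ 0 < C ∧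
    ∀ t, 0 ≤ t → t ^ n ≤ C * Real.exp (l * ω t) := by
  -- The exponent `(n + 1) / b`, rather than `n / b`, stays positive for `n = 0`.
  refine ⟨Real.exp (-((n + 1) / b) * a), (n + 1) / b, div_pos (by positivity) h.b_pos,
    Real.exp_pos _, fun t ht => ?_⟩
  have hb := h.b_pos
  have h1 : Real.exp (n * Real.log (1 + t)) ≤ Real.exp ((n + 1) / b * (ω t - a)) := by
    refine Real.exp_le_exp.2 ?_
    have h2 : Real.log (1 + t) ≤ (ω t - a) / b := by
      rw [le_div_iff₀ hb]
      linarith [h.gamma t ht]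
    have h3 : 0 ≤ Real.log (1 + t) := Real.log_nonneg (by linarith)
    calc (n : ℝ) * Real.log (1 + t) ≤ (n + 1) * Real.log (1 + t) := by gcongr; linarith
      _ ≤ (n + 1) * ((ω t - a) / b) := by gcongr
      _ = _ := by ring
  calc t ^ n ≤ (1 + t) ^ n := by gcongr; linarith
    _ = Real.exp (n * Real.log (1 + t)) := by
      rw [mul_comm, Real.exp_mul, Real.exp_log (by linarith), Real.rpow_natCast]
    _ ≤ _ := h1
    _ = _ := by rw [← Real.exp_add]; ring_nf

end IsWeightFunction

/-- The weight `e^{lω(x)}` with values in `[0,∞]`. -/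
noncomputable def expWeight {V : Type*} [NormedAddCommGroup V] (ω : ℝ → ℝ) (l : ℝ) (x : V) : ℝ≥0∞ :=
  ENNReal.ofReal (Real.exp (l * ω ‖x‖))

section ExpWeight

variable {ω : ℝ → ℝ} {K a b : ℝ} {V : Type*} [NormedAddCommGroup V]

theorem expWeight_ne_top (l : ℝ) (x : V) : expWeight ω l x ≠ ∞ := ENNReal.ofReal_ne_top

theorem expWeight_add (l m : ℝ) (x : V) :
    expWeight ω (l + m) x = expWeight ω l x * expWeight ω m x := by
  rw [expWeight, expWeight, expWeight, ← ENNReal.ofReal_mul (Real.exp_pos _).le, ← Real.exp_add,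
    add_mul]

theorem enorm_exp_smul {G : Type*} [NormedAddCommGroup G] [NormedSpace ℝ G] (l : ℝ) (x : V)
    (y : G) : ‖Real.exp (l * ω ‖x‖) • y‖ₑ = expWeight ω l x * ‖y‖ₑ := by
  rw [enorm_smul, Real.enorm_eq_ofReal (Real.exp_pos _).le, expWeight]

theorem IsWeightFunction.expWeight_mono (h : IsWeightFunction ω K a b) {l m : ℝ} (hlm : l ≤ m)
    (x : V) : expWeight ω l x ≤ expWeight ω m x := by
  refine ENNReal.ofReal_le_ofReal (Real.exp_le_exp.2 ?_)
  gcongr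
  exact h.nonneg _ (norm_nonneg x)

theorem IsWeightFunction.continuous_expWeight (h : IsWeightFunction ω K a b) (l : ℝ) :
    Continuous (expWeight ω l : V → ℝ≥0∞) :=
  ENNReal.continuous_ofReal.comp (h.continuous_exp l)

/-- The three vectors may live in different spaces, so that a point of phase space can be compared
with its two coordinates. -/
theorem IsWeightFunction.expWeight_le_mul (h : IsWeightFunction ω K a b) {l : ℝ} (hl : 0 ≤ l)
    {W : Type*} [NormedAddCommGroup W] {U : Type*} [NormedAddCommGroup U]
    {x : V} {y : W} {z : U} (hxyz : ‖x‖ ≤ ‖y‖ + ‖z‖) :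
    expWeight ω l x ≤ ENNReal.ofReal (Real.exp (K * l)) *
      (expWeight ω (K * l) y * expWeight ω (K * l) z) := by
  simp only [expWeight]
  rw [← ENNReal.ofReal_mul (Real.exp_pos _).le, ← ENNReal.ofReal_mul (Real.exp_pos _).le,
    ← Real.exp_add, ← Real.exp_add]
  refine ENNReal.ofReal_le_ofReal (Real.exp_le_exp.2 ?_)
  have := mul_le_mul_of_nonneg_left
    (h.le_of_le_add (norm_nonneg y) (norm_nonneg z) (norm_nonneg x) hxyz) hl
  linarith

/-- A midpoint is no longer than the longer of its two endpoints, so `le_of_le_max` applies and `l`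
is not multiplied by `K`. -/
theorem IsWeightFunction.expWeight_le_mul_of_midpoint (h : IsWeightFunction ω K a b) {l : ℝ}
    (hl : 0 ≤ l) [NormedSpace ℝ V] (x y : V) :
    expWeight ω l x ≤ expWeight ω l y * expWeight ω l ((2 : ℝ) • x - y) := by
  simp only [expWeight]
  rw [← ENNReal.ofReal_mul (Real.exp_pos _).le, ← Real.exp_add]
  refine ENNReal.ofReal_le_ofReal (Real.exp_le_exp.2 ?_)
  have h1 : ‖x‖ ≤ max ‖y‖ ‖(2 : ℝ) • x - y‖ := by
    have h2 : 2 * ‖x‖ ≤ ‖y‖ + ‖(2 : ℝ) • x - y‖ := by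
      calc 2 * ‖x‖ = ‖(2 : ℝ) • x‖ := by rw [norm_smul]; norm_num
        _ = ‖y + ((2 : ℝ) • x - y)‖ := by rw [add_sub_cancel]
        _ ≤ _ := norm_add_le _ _
    linarith [le_max_left ‖y‖ ‖(2 : ℝ) • x - y‖, le_max_right ‖y‖ ‖(2 : ℝ) • x - y‖]
  have := mul_le_mul_of_nonneg_left
    (h.le_of_le_max (norm_nonneg y) (norm_nonneg _) (norm_nonneg x) h1) hl
  linarith

end ExpWeight

/-! ### Weighted Lebesgue norms and Hölder's inequality. -/

section WeightedNorm

variable {ω : ℝ → ℝ} {K a b : ℝ} {V : Type*} [NormedAddCommGroup V] [InnerProductSpace ℝ V]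
  [FiniteDimensional ℝ V] [MeasurableSpace V] [BorelSpace V]
  {G : Type*} [NormedAddCommGroup G] [NormedSpace ℝ G]

theorem lintegral_enorm_mul_enorm_le {α E F : Type*} [MeasurableSpace α] {μ : Measure α}
    [NormedAddCommGroup E] [NormedAddCommGroup F] (p q : ℝ≥0∞) [p.HolderConjugate q]
    {f : α → E} {g : α → F} (hf : AEStronglyMeasurable f μ) (hg : AEStronglyMeasurable g μ) :
    ∫⁻ x, ‖f x‖ₑ * ‖g x‖ₑ ∂μ ≤ eLpNorm f p μ * eLpNorm g q μ := by
  have := eLpNorm_smul_le_mul_eLpNorm (p := p) (q := q) (r := 1) hg.norm hf.norm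
  rw [eLpNorm_norm, eLpNorm_norm, eLpNorm_one_eq_lintegral_enorm] at this
  simpa [enorm_mul] using this

theorem weightedNorm_top (l : ℝ) (F : V → G) :
    weightedNorm ω ∞ l F = essSup (fun x => expWeight ω l x * ‖F x‖ₑ) volume := by
  simp only [weightedNorm, eLpNorm_exponent_top, eLpNormEssSup, enorm_exp_smul]

theorem weightedNorm_top_le {l : ℝ} {F : V → G} {B : ℝ≥0∞}
    (h : ∀ x, expWeight ω l x * ‖F x‖ₑ ≤ B) : weightedNorm ω ∞ l F ≤ B := by
  rw [weightedNorm_top]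
  exact essSup_le_of_ae_le _ (Eventually.of_forall h)

theorem ae_le_weightedNorm_top (l : ℝ) (F : V → G) :
    ∀ᵐ x, expWeight ω l x * ‖F x‖ₑ ≤ weightedNorm ω ∞ l F := by
  rw [weightedNorm_top]
  exact ae_le_essSup

theorem weightedNorm_one (l : ℝ) (F : V → G) :
    weightedNorm ω 1 l F = ∫⁻ x, expWeight ω l x * ‖F x‖ₑ := by
  simp only [weightedNorm, eLpNorm_one_eq_lintegral_enorm, enorm_exp_smul]

theorem IsWeightFunction.weightedNorm_mono (h : IsWeightFunction ω K a b) (p : ℝ≥0∞) {l m : ℝ}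
    (hlm : l ≤ m) (F : V → G) : weightedNorm ω p l F ≤ weightedNorm ω p m F := by
  refine eLpNorm_mono_enorm fun x => ?_
  rw [enorm_exp_smul, enorm_exp_smul]
  gcongr
  exact h.expWeight_mono hlm x

theorem IsWeightFunction.aestronglyMeasurable_exp_smul (h : IsWeightFunction ω K a b) (l : ℝ)
    {F : V → G} (hF : AEStronglyMeasurable F volume) :
    AEStronglyMeasurable (fun x => Real.exp (l * ω ‖x‖) • F x) volume :=
  (h.continuous_exp l).aestronglyMeasurable.smul hF

/-- Hölder, because `x ↦ z - x` preserves volume. It is used at `z` for the convolution with `σ` and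
at `2z` for the Rihaczek form. -/
theorem IsWeightFunction.lintegral_weighted_mul_comp_sub_le (h : IsWeightFunction ω K a b)
    (p q : ℝ≥0∞) [p.HolderConjugate q] {H : Type*} [NormedAddCommGroup H] [NormedSpace ℝ H]
    (l m : ℝ) {F : V → G} {F' : V → H}
    (hF : AEStronglyMeasurable F volume) (hF' : AEStronglyMeasurable F' volume) (z : V) :
    ∫⁻ x, (expWeight ω l x * ‖F x‖ₑ) * (expWeight ω m (z - x) * ‖F' (z - x)‖ₑ) ≤
      weightedNorm ω p l F * weightedNorm ω q m F' := by
  have hmp : MeasurePreserving (fun x : V => z - x) volume volume :=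
    Measure.measurePreserving_sub_left volume z
  have hm := h.aestronglyMeasurable_exp_smul m hF'
  have := lintegral_enorm_mul_enorm_le p q (h.aestronglyMeasurable_exp_smul l hF)
    (hm.comp_measurePreserving hmp)
  rw [eLpNorm_comp_measurePreserving hm hmp] at this
  simpa only [enorm_exp_smul, Function.comp_apply, weightedNorm] using this

/-- Hölder for `e^{mω}F = e^{-lω} · e^{(m+l)ω}F`: a larger weight buys a smaller integrability
exponent. -/
theorem IsWeightFunction.weightedNorm_le_mul (h : IsWeightFunction ω K a b) (p q r : ℝ≥0∞)
    [p.HolderTriple q r] (l m : ℝ) {F : V → G} (hF : AEStronglyMeasurable F volume) :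
    weightedNorm ω r m F ≤
      weightedNorm ω p (-l) (fun _ : V => (1 : ℝ)) * weightedNorm ω q (m + l) F := by
  have := eLpNorm_smul_le_mul_eLpNorm (p := p) (q := q) (r := r)
    (h.aestronglyMeasurable_exp_smul (m + l) hF)
    (h.aestronglyMeasurable_exp_smul (V := V) (-l) (aestronglyMeasurable_const (b := (1 : ℝ))))
  refine le_trans (le_of_eq ?_) this
  refine congrArg (fun f => eLpNorm f r volume) (funext fun x => ?_)
  simp only [Pi.smul_apply', smul_eq_mul, mul_one, smul_smul, ← Real.exp_add]
  congr 2
  ring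

/-- The `p`-th power of `e^{-lω}` is `e^{-lpω}`. In dimension `2N`, exponents `2` and `(2p)'` yield
the thresholds `N/b` and `2N/(b(2p)')`. -/
theorem IsWeightFunction.weightedNorm_exp_neg_lt_top (h : IsWeightFunction ω K a b) {p : ℝ≥0∞}
    (hp : 1 ≤ p) (hp' : p ≠ ∞) {l : ℝ} (hl : 0 ≤ l)
    (hd : (Module.finrank ℝ V : ℝ) < l * p.toReal * b) :
    weightedNorm ω p (-l) (fun _ : V => (1 : ℝ)) < ∞ := by
  have hp0 : p ≠ 0 := (zero_lt_one.trans_le hp).ne'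
  have hpos : 0 < p.toReal := ENNReal.toReal_pos hp0 hp'
  rw [weightedNorm, eLpNorm_lt_top_iff_lintegral_rpow_enorm_lt_top hp0 hp']
  have := (h.integrable_exp_neg (volume : Measure V) (mul_nonneg hl hpos.le) hd).2
  rw [HasFiniteIntegral] at this
  refine lt_of_le_of_lt (le_of_eq (lintegral_congr fun x => ?_)) this
  rw [smul_eq_mul, mul_one, Real.enorm_eq_ofReal (Real.exp_pos _).le,
    Real.enorm_eq_ofReal (Real.exp_pos _).le, ENNReal.ofReal_rpow_of_pos (Real.exp_pos _),
    ← Real.exp_mul]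
  ring_nf

end WeightedNorm

end Weights

/-! ### Fourier inversion, Parseval and symmetries in the normalization `e^{-ix·ξ}`. -/

section Fourier

variable {V : Type*} [NormedAddCommGroup V] [InnerProductSpace ℝ V] [FiniteDimensional ℝ V]
  [MeasurableSpace V] [BorelSpace V]

open FourierTransform

theorem norm_exp_neg_I_mul (r : ℝ) : ‖Complex.exp (-(Complex.I * (r : ℂ)))‖ = 1 := by
  rw [← mul_neg, ← Complex.ofReal_neg, mul_comm, Complex.norm_exp_ofReal_mul_I]

theorem enorm_exp_neg_I_mul (r : ℝ) : ‖Complex.exp (-(Complex.I * (r : ℂ)))‖ₑ = 1 := by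
  rw [← ofReal_norm, norm_exp_neg_I_mul, ENNReal.ofReal_one]

theorem enorm_conj (z : ℂ) : ‖(starRingEnd ℂ) z‖ₑ = ‖z‖ₑ := by
  rw [← ofReal_norm, RCLike.norm_conj, ofReal_norm]

/-- The bilinear form `(2π)⁻¹ ⟨x, ξ⟩` for which Mathlib's general Fourier integral is
`fourierHat`. -/
noncomputable def fourierForm (V : Type*) [NormedAddCommGroup V] [InnerProductSpace ℝ V] :
    V →L[ℝ] V →L[ℝ] ℝ :=
  (2 * Real.pi)⁻¹ • innerSL ℝ

theorem toLinearMap_fourierForm_apply (x y : V) :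
    ContinuousLinearMap.toLinearMap₁₂ (fourierForm V) x y = (2 * Real.pi)⁻¹ * inner ℝ x y := rfl

/-- One of two bridges to Mathlib: the bilinear-form version supplies the multiplication formula and
the derivatives of the transform, while the rescaling in `fourierHat_eq_fourier` supplies inversion.
-/
theorem fourierHat_eq_fourierIntegral (f : V → ℂ) :
    fourierHat f = VectorFourier.fourierIntegral Real.fourierChar volume
      (ContinuousLinearMap.toLinearMap₁₂ (fourierForm V)) f := by
  funext ξ
  simp only [fourierHat, VectorFourier.fourierIntegral]
  refine integral_congr_ae (Eventually.of_forall fun x => ?_)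
  simp only [Circle.smul_def, smul_eq_mul, Real.fourierChar_apply,
    toLinearMap_fourierForm_apply]
  congr 2
  have : (Real.pi : ℂ) ≠ 0 := by exact_mod_cast Real.pi_ne_zero
  push_cast
  field_simp

theorem fourierHat_eq_fourier (f : V → ℂ) (ξ : V) :
    fourierHat f ξ = 𝓕 f ((2 * Real.pi)⁻¹ • ξ) := by
  rw [Real.fourier_eq]
  simp only [fourierHat]
  refine integral_congr_ae (Eventually.of_forall fun x => ?_)
  simp only [Circle.smul_def, smul_eq_mul, Real.fourierChar_apply, inner_smul_right]
  congr 2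
  have : (Real.pi : ℂ) ≠ 0 := by exact_mod_cast Real.pi_ne_zero
  push_cast
  field_simp

theorem fourier_eq_fourierHat (f : V → ℂ) (ξ : V) :
    𝓕 f ξ = fourierHat f ((2 * Real.pi) • ξ) := by
  rw [fourierHat_eq_fourier, smul_smul, inv_mul_cancel₀ (by positivity), one_smul]

theorem continuous_fourierHat {f : V → ℂ} (hf : Integrable f volume) :
    Continuous (fourierHat f) := by
  rw [fourierHat_eq_fourierIntegral]
  exact VectorFourier.fourierIntegral_continuous Real.continuous_fourierChar
    (by simp only [toLinearMap_fourierForm_apply]; fun_prop) hf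

theorem lintegral_comp_smul (f : V → ℝ≥0∞) {r : ℝ} (hr : r ≠ 0) :
    ∫⁻ x, f (r • x) = ENNReal.ofReal |(r ^ Module.finrank ℝ V)⁻¹| * ∫⁻ x, f x := by
  have h := (Homeomorph.smulOfNeZero r hr).measurableEmbedding.lintegral_map f
    (μ := (volume : Measure V))
  have h2 : ((Homeomorph.smulOfNeZero r hr : V ≃ₜ V) : V → V) = fun x => r • x := rfl
  rw [h2, Measure.map_addHaar_smul _ hr, lintegral_smul_measure] at h
  exact h.symm

theorem fourierHat_fourierHat {f : V → ℂ} (hc : Continuous f) (hf : Integrable f volume)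
    (hf' : Integrable (fourierHat f) volume) (x : V) :
    fourierHat (fourierHat f) x = ((2 * Real.pi) ^ Module.finrank ℝ V : ℝ) * f (-x) := by
  have hpi : (2 * Real.pi) ≠ 0 := by positivity
  have h1 : Integrable (𝓕 f) volume := by
    have : 𝓕 f = fun ξ => fourierHat f ((2 * Real.pi) • ξ) := funext (fourier_eq_fourierHat f)
    rw [this]
    exact hf'.comp_smul hpi
  have h2 := congrFun (hc.fourierInv_fourier_eq hf h1) (-x)
  rw [Real.fourierInv_eq_fourier_neg, neg_neg, fourier_eq_fourierHat] at h2
  rw [← h2]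
  simp only [fourierHat, fourier_eq_fourierHat]
  rw [← Complex.real_smul]
  -- The substitution `ξ ↦ 2πξ` produces the constant `(2π)^d`.
  have h3 := Measure.integral_comp_smul (volume : Measure V)
    (fun ξ => Complex.exp (-(Complex.I * (inner ℝ ξ x : ℝ))) * fourierHat f ξ) (2 * Real.pi)
  rw [abs_of_pos (by positivity)] at h3
  have h4 := congrArg (fun z => ((2 * Real.pi) ^ Module.finrank ℝ V : ℝ) • z) h3
  simp only [smul_smul] at h4
  rw [mul_inv_cancel₀ (by positivity), one_smul] at h4
  refine h4.symm.trans ?_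
  congr 1
  refine integral_congr_ae (Eventually.of_forall fun y => ?_)
  simp only [inner_smul_left, inner_smul_right, fourierHat]
  rfl

theorem enorm_fourierHat_le (f : V → ℂ) (ξ : V) : ‖fourierHat f ξ‖ₑ ≤ ∫⁻ x, ‖f x‖ₑ := by
  refine (enorm_integral_le_lintegral_enorm _).trans (le_of_eq (lintegral_congr fun x => ?_))
  rw [enorm_mul, enorm_exp_neg_I_mul, one_mul]

variable (V) in
/-- The constant `(2π)^d` of the Fourier inversion formula on a space of dimension `d`. -/
noncomputable def fourierConst : ℝ := (2 * Real.pi) ^ Module.finrank ℝ V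

variable (V) in
theorem fourierConst_pos : 0 < fourierConst V := by
  unfold fourierConst
  positivity

variable (V) in
theorem enorm_fourierConst : ‖((fourierConst V : ℝ) : ℂ)‖ₑ = ENNReal.ofReal (fourierConst V) := by
  rw [← ofReal_norm, Complex.norm_real, Real.norm_of_nonneg (fourierConst_pos V).le]

/-- Inversion as an inequality in `[0,∞]`: if the transform is not integrable the right side is
infinite, so its integrability need not be known beforehand. -/
theorem enorm_le_lintegral_fourierHat {f : V → ℂ} (hc : Continuous f) (hf : Integrable f volume)
    (x : V) : ENNReal.ofReal (fourierConst V) * ‖f x‖ₑ ≤ ∫⁻ ξ, ‖fourierHat f ξ‖ₑ := by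
  by_cases h : Integrable (fourierHat f) volume
  · have h1 := fourierHat_fourierHat hc hf h (-x)
    have h2 := enorm_fourierHat_le (fourierHat f) (-x)
    rw [h1, neg_neg, enorm_mul] at h2
    rwa [← enorm_fourierConst]
  · have : ¬ HasFiniteIntegral (fourierHat f) volume :=
      fun h' => h ⟨(continuous_fourierHat hf).aestronglyMeasurable, h'⟩
    rw [HasFiniteIntegral, not_lt, top_le_iff] at this
    rw [this]
    exact le_top

/-- Continuous integrable functions with integrable Fourier transform. -/
structure FourierInvertible (f : V → ℂ) : Prop where
  continuous : Continuous f
  integrable : Integrable f volume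
  integrable_hat : Integrable (fourierHat f) volume

theorem integral_fourierHat_mul {f g : V → ℂ} (hf : Integrable f volume)
    (hg : Integrable g volume) :
    ∫ ξ, fourierHat f ξ * g ξ = ∫ x, f x * fourierHat g x := by
  have h := VectorFourier.integral_fourierIntegral_smul_eq_flip
    (L := ContinuousLinearMap.toLinearMap₁₂ (fourierForm V)) (μ := volume) (ν := volume)
    Real.continuous_fourierChar
    (by simp only [toLinearMap_fourierForm_apply]; fun_prop) hf hg
  have hflip : (ContinuousLinearMap.toLinearMap₁₂ (fourierForm V)).flip =
      ContinuousLinearMap.toLinearMap₁₂ (fourierForm V) := by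
    refine LinearMap.ext₂ fun x y => ?_
    rw [LinearMap.flip_apply, toLinearMap_fourierForm_apply, toLinearMap_fourierForm_apply,
      real_inner_comm]
  rw [hflip, ← fourierHat_eq_fourierIntegral, ← fourierHat_eq_fourierIntegral] at h
  exact h

theorem fourierHat_conj (f : V → ℂ) (ξ : V) :
    fourierHat (fun x => (starRingEnd ℂ) (f x)) ξ = (starRingEnd ℂ) (fourierHat f (-ξ)) := by
  simp only [fourierHat]
  rw [← integral_conj]
  refine integral_congr_ae (Eventually.of_forall fun x => ?_)
  simp only [map_mul, ← Complex.exp_conj, map_neg, Complex.conj_I, Complex.conj_ofReal,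
    inner_neg_right]
  congr 2
  push_cast
  ring

theorem fourierHat_comp_neg (f : V → ℂ) (ξ : V) :
    fourierHat (fun x => f (-x)) ξ = fourierHat f (-ξ) := by
  simp only [fourierHat]
  rw [← integral_neg_eq_self]
  simp

/-- Parseval's formula. -/
theorem integral_fourierHat_mul_conj {f g : V → ℂ} (hf : FourierInvertible f)
    (hg : Integrable g volume) :
    ∫ ξ, fourierHat f ξ * (starRingEnd ℂ) (fourierHat g ξ) =
      (fourierConst V : ℝ) * ∫ x, f x * (starRingEnd ℂ) (g x) := by
  have hg' : Integrable (fun x => (starRingEnd ℂ) (g x)) volume :=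
    (LinearIsometryEquiv.integrable_comp_iff (Complex.conjLIE)).2 hg
  -- The transform of `conj g` is `conj ĝ(-·)`, and that of `f̂(-·)` is `(2π)^d f` by inversion.
  have h := integral_fourierHat_mul hg' (hf.integrable_hat.comp_neg)
  rw [← integral_neg_eq_self]
  refine Eq.trans ?_ (h.trans ?_)
  · refine integral_congr_ae (Eventually.of_forall fun x => ?_)
    simp only [fourierHat_conj]
    ring
  · rw [← integral_const_mul]
    refine integral_congr_ae (Eventually.of_forall fun x => ?_)
    simp only [fourierHat_comp_neg,
      fourierHat_fourierHat hf.continuous hf.integrable hf.integrable_hat, neg_neg, fourierConst]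
    ring

theorem enorm_integral_mul_conj_le {f g : V → ℂ} (hf : FourierInvertible f)
    (hg : Integrable g volume) :
    ENNReal.ofReal (fourierConst V) * ‖∫ x, f x * (starRingEnd ℂ) (g x)‖ₑ ≤
      ∫⁻ ξ, ‖fourierHat f ξ‖ₑ * ‖fourierHat g ξ‖ₑ := by
  rw [← enorm_fourierConst, ← enorm_mul, ← integral_fourierHat_mul_conj hf hg]
  refine (enorm_integral_le_lintegral_enorm _).trans (le_of_eq (lintegral_congr fun x => ?_))
  rw [enorm_mul, enorm_conj]

theorem fourierHat_translate (f : V → ℂ) (x ξ : V) :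
    fourierHat (fun y => f (x + y)) ξ =
      Complex.exp (Complex.I * (inner ℝ x ξ : ℝ)) * fourierHat f ξ := by
  simp only [fourierHat]
  rw [← integral_const_mul, ← integral_add_left_eq_self (μ := volume)
    (fun y => Complex.exp (Complex.I * (inner ℝ x ξ : ℝ)) *
      (Complex.exp (-(Complex.I * (inner ℝ y ξ : ℝ))) * f y)) x]
  refine integral_congr_ae (Eventually.of_forall fun y => ?_)
  simp only [← mul_assoc, ← Complex.exp_add, inner_add_left]
  congr 2
  push_cast
  ring

theorem fourierHat_modulate (f : V → ℂ) (η ξ : V) :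
    fourierHat (fun y => Complex.exp (-(Complex.I * (inner ℝ y η : ℝ))) * f y) ξ =
      fourierHat f (ξ + η) := by
  simp only [fourierHat]
  refine integral_congr_ae (Eventually.of_forall fun y => ?_)
  simp only [← mul_assoc, ← Complex.exp_add, inner_add_right]
  congr 2
  push_cast
  ring

theorem fourierHat_dilate (f : V → ℂ) {r : ℝ} (hr : r ≠ 0) (ξ : V) :
    fourierHat (fun y => f (r • y)) ξ =
      (|(r ^ Module.finrank ℝ V)⁻¹| : ℝ) * fourierHat f (r⁻¹ • ξ) := by
  simp only [fourierHat]
  rw [← Complex.real_smul, ← Measure.integral_comp_smul]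
  refine integral_congr_ae (Eventually.of_forall fun y => ?_)
  have : r⁻¹ * (r * inner ℝ y ξ) = inner ℝ y ξ := inv_mul_cancel_left₀ hr _
  simp only [inner_smul_left, inner_smul_right, RCLike.conj_to_real, this]

namespace FourierInvertible

variable {f : V → ℂ}

theorem continuous_hat (hf : FourierInvertible f) : Continuous (fourierHat f) :=
  continuous_fourierHat hf.integrable

theorem hat (hf : FourierInvertible f) : FourierInvertible (fourierHat f) where
  continuous := hf.continuous_hat
  integrable := hf.integrable_hat
  integrable_hat := by
    have : fourierHat (fourierHat f) =
        fun x => ((2 * Real.pi) ^ Module.finrank ℝ V : ℝ) * f (-x) :=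
      funext fun x => fourierHat_fourierHat hf.continuous hf.integrable hf.integrable_hat x
    rw [this]
    exact hf.integrable.comp_neg.const_mul _

theorem comp_neg (hf : FourierInvertible f) : FourierInvertible fun x => f (-x) where
  continuous := hf.continuous.comp continuous_neg
  integrable := hf.integrable.comp_neg
  integrable_hat := by
    have : fourierHat (fun x => f (-x)) = fun ξ => fourierHat f (-ξ) :=
      funext (fourierHat_comp_neg f)
    rw [this]
    exact hf.integrable_hat.comp_neg

theorem translate (hf : FourierInvertible f) (x : V) : FourierInvertible fun y => f (x + y) where
  continuous := hf.continuous.comp (by fun_prop)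
  integrable := hf.integrable.comp_add_left x
  integrable_hat := by
    rw [funext (fourierHat_translate f x)]
    refine hf.integrable_hat.bdd_mul (c := 1) (by fun_prop) (Eventually.of_forall fun ξ => ?_)
    rw [mul_comm, Complex.norm_exp_ofReal_mul_I]

theorem dilate (hf : FourierInvertible f) {r : ℝ} (hr : r ≠ 0) :
    FourierInvertible fun y => f (r • y) where
  continuous := hf.continuous.comp (by fun_prop)
  integrable := hf.integrable.comp_smul hr
  integrable_hat := by
    rw [funext (fourierHat_dilate f hr)]
    exact (hf.integrable_hat.comp_smul (inv_ne_zero hr)).const_mul _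

theorem modulate (hf : FourierInvertible f) (η : V) :
    FourierInvertible fun y => Complex.exp (-(Complex.I * (inner ℝ y η : ℝ))) * f y where
  continuous := by
    have := hf.continuous
    fun_prop
  integrable := integrable_fourier_kernel_mul hf.integrable η
  integrable_hat := by
    rw [funext (fourierHat_modulate f η)]
    exact hf.integrable_hat.comp_add_right η

theorem conj (hf : FourierInvertible f) : FourierInvertible fun y => (starRingEnd ℂ) (f y) where
  continuous := Complex.continuous_conj.comp hf.continuous
  integrable := (LinearIsometryEquiv.integrable_comp_iff (Complex.conjLIE)).2 hf.integrable
  integrable_hat := by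
    rw [funext (fourierHat_conj f)]
    exact (LinearIsometryEquiv.integrable_comp_iff (Complex.conjLIE)).2 hf.integrable_hat.comp_neg

/-- By inversion, `f` is bounded by a multiple of the `L¹` norm of its transform. -/
theorem exists_norm_le (hf : FourierInvertible f) : ∃ C, ∀ x, ‖f x‖ ≤ C := by
  refine ⟨((∫⁻ ξ, ‖fourierHat f ξ‖ₑ) / ENNReal.ofReal (fourierConst V)).toReal, fun x => ?_⟩
  have h := enorm_le_lintegral_fourierHat hf.continuous hf.integrable x
  have hc : ENNReal.ofReal (fourierConst V) ≠ 0 := by simpa using fourierConst_pos V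
  rw [← toReal_enorm]
  refine ENNReal.toReal_mono (ENNReal.div_ne_top hf.integrable_hat.2.ne hc) ?_
  rwa [ENNReal.le_div_iff_mul_le (Or.inl hc) (Or.inl ENNReal.ofReal_ne_top), mul_comm]

theorem integrable_mul {g : V → ℂ} (hf : FourierInvertible f) (hg : Integrable g volume) :
    Integrable (fun x => f x * g x) volume := by
  obtain ⟨C, hC⟩ := hf.exists_norm_le
  exact hg.bdd_mul hf.continuous.aestronglyMeasurable (Eventually.of_forall hC)

end FourierInvertible

theorem SchwartzMap.fourierInvertible (g : 𝓢(V, ℂ)) : FourierInvertible (g : V → ℂ) where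
  continuous := g.continuous
  integrable := g.integrable
  integrable_hat := by
    have : fourierHat (g : V → ℂ) = fun ξ => (𝓕 g) ((2 * Real.pi)⁻¹ • ξ) := by
      funext ξ
      rw [fourierHat_eq_fourier, SchwartzMap.fourier_coe]
    rw [this]
    exact (𝓕 g).integrable.comp_smul (by positivity)

end Fourier

/-! ### Decay faster than every `e^{-lω}`, and its transfer to derivatives. -/

section RapidDecay

variable {V : Type*} [NormedAddCommGroup V] {E : Type*} [NormedAddCommGroup E]
  {ω : ℝ → ℝ} {K a b : ℝ}

/-- `F` decays faster than every `e^{-lω}`. -/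
def RapidDecay (ω : ℝ → ℝ) (F : V → E) : Prop :=
  ∀ l : ℝ, ∃ C : ℝ, ∀ x, Real.exp (l * ω ‖x‖) * ‖F x‖ ≤ C

theorem RapidDecay.exists_nonneg {F : V → E} (hF : RapidDecay ω F) (l : ℝ) :
    ∃ C : ℝ, 0 ≤ C ∧ ∀ x, Real.exp (l * ω ‖x‖) * ‖F x‖ ≤ C := by
  obtain ⟨C, hC⟩ := hF l
  exact ⟨max C 0, le_max_right _ _, fun x => (hC x).trans (le_max_left _ _)⟩

theorem IsWeightFunction.rapidDecay_of_pos (h : IsWeightFunction ω K a b) {F : V → E}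
    (hF : ∀ l : ℝ, 0 < l → ∃ C : ℝ, ∀ x, Real.exp (l * ω ‖x‖) * ‖F x‖ ≤ C) : RapidDecay ω F := by
  intro l
  obtain ⟨C, hC⟩ := hF (max l 1) (lt_max_of_lt_right one_pos)
  refine ⟨C, fun x => le_trans ?_ (hC x)⟩
  gcongr
  · exact h.nonneg _ (norm_nonneg x)
  · exact le_max_left _ _

theorem RapidDecay.mono {F : V → E} {E' : Type*} [NormedAddCommGroup E'] {G : V → E'}
    (hF : RapidDecay ω F) {c : ℝ} (hc : 0 ≤ c) (hG : ∀ x, ‖G x‖ ≤ c * ‖F x‖) :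
    RapidDecay ω G := by
  intro l
  obtain ⟨C, hC⟩ := hF l
  refine ⟨c * C, fun x => ?_⟩
  calc Real.exp (l * ω ‖x‖) * ‖G x‖ ≤ Real.exp (l * ω ‖x‖) * (c * ‖F x‖) := by gcongr; exact hG x
    _ = c * (Real.exp (l * ω ‖x‖) * ‖F x‖) := by ring
    _ ≤ c * C := by gcongr; exact hC x

/-- Condition (α) absorbs the factor `2`; needed for reflections and for the half-scaling of phase
space in `fourierHat_crossWigner`. -/
theorem RapidDecay.comp_of_le_two_mul (h : IsWeightFunction ω K a b) {V' : Type*}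
    [NormedAddCommGroup V'] {F : V → E} (hF : RapidDecay ω F) {A : V' → V}
    (hA : ∀ x, ‖x‖ ≤ 2 * ‖A x‖) : RapidDecay ω (F ∘ A) := by
  refine h.rapidDecay_of_pos fun l hl => ?_
  obtain ⟨C, hC⟩ := hF (l * K)
  refine ⟨Real.exp (l * K) * C, fun x => ?_⟩
  have h1 : Real.exp (l * ω ‖x‖) ≤ Real.exp (l * K) * Real.exp (l * K * ω ‖A x‖) := by
    rw [← Real.exp_add]
    refine Real.exp_le_exp.2 ?_
    have := mul_le_mul_of_nonneg_left
      (h.le_of_le_two_mul (norm_nonneg _) (norm_nonneg x) (hA x)) hl.le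
    linarith
  calc Real.exp (l * ω ‖x‖) * ‖(F ∘ A) x‖
      ≤ (Real.exp (l * K) * Real.exp (l * K * ω ‖A x‖)) * ‖F (A x)‖ := by
        gcongr; exact le_rfl
    _ = Real.exp (l * K) * (Real.exp (l * K * ω ‖A x‖) * ‖F (A x)‖) := by ring
    _ ≤ _ := by gcongr; exact hC _

/-- Covers translations, and with `r = 0` reflections and restrictions to slices of phase space. -/
theorem RapidDecay.comp_of_le_add (h : IsWeightFunction ω K a b) {V' : Type*}
    [NormedAddCommGroup V'] {F : V → E} (hF : RapidDecay ω F) {A : V' → V} {r : ℝ} (hr : 0 ≤ r)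
    (hA : ∀ x, ‖x‖ ≤ r + ‖A x‖) : RapidDecay ω (F ∘ A) := by
  refine h.rapidDecay_of_pos fun l hl => ?_
  obtain ⟨C, hC⟩ := hF (l * K)
  refine ⟨Real.exp (l * K * (1 + ω r)) * C, fun x => ?_⟩
  have h1 : Real.exp (l * ω ‖x‖) ≤
      Real.exp (l * K * (1 + ω r)) * Real.exp (l * K * ω ‖A x‖) := by
    rw [← Real.exp_add]
    refine Real.exp_le_exp.2 ?_
    have := mul_le_mul_of_nonneg_left
      (h.le_of_le_add hr (norm_nonneg _) (norm_nonneg x) (hA x)) hl.le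
    linarith
  calc Real.exp (l * ω ‖x‖) * ‖(F ∘ A) x‖
      ≤ (Real.exp (l * K * (1 + ω r)) * Real.exp (l * K * ω ‖A x‖)) * ‖F (A x)‖ := by
        gcongr; exact le_rfl
    _ = Real.exp (l * K * (1 + ω r)) * (Real.exp (l * K * ω ‖A x‖) * ‖F (A x)‖) := by ring
    _ ≤ _ := by gcongr; exact hC _

/-- Interpolation: a bound on the second derivative transfers rapid decay to the first one. -/
theorem RapidDecay.fderiv_of_bounded [NormedSpace ℝ V] [NormedSpace ℝ E]
    (h : IsWeightFunction ω K a b)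
    {F : V → E} (hF : RapidDecay ω F) (hd : Differentiable ℝ F)
    (hd2 : Differentiable ℝ (fderiv ℝ F)) {M : ℝ} (hM : ∀ x, ‖fderiv ℝ (fderiv ℝ F) x‖ ≤ M) :
    RapidDecay ω (fderiv ℝ F) := by
  refine h.rapidDecay_of_pos fun l hl => ?_
  have hM0 : 0 ≤ M := (norm_nonneg (fderiv ℝ (fderiv ℝ F) 0)).trans (hM 0)
  obtain ⟨C₁, hC₁0, hC₁⟩ := hF.exists_nonneg (2 * l)
  -- The value at a neighbour `x + v` is controlled by the weight at `x`, uniformly for `‖v‖ ≤ 1`.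
  have hF2 : ∀ v : V, ‖v‖ ≤ 1 → ∀ x, Real.exp (2 * l * ω ‖x‖) * ‖F (x + v)‖ ≤
      Real.exp (2 * l * K * (1 + ω 1)) * (hF.exists_nonneg (2 * l * K)).choose := by
    intro v hv x
    obtain ⟨hC0, hC⟩ := (hF.exists_nonneg (2 * l * K)).choose_spec
    have hx : ‖x‖ ≤ 1 + ‖x + v‖ := by
      calc ‖x‖ = ‖(x + v) - v‖ := by rw [add_sub_cancel_right]
        _ ≤ ‖x + v‖ + ‖v‖ := norm_sub_le _ _
        _ ≤ _ := by linarith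
    have h1 : Real.exp (2 * l * ω ‖x‖) ≤
        Real.exp (2 * l * K * (1 + ω 1)) * Real.exp (2 * l * K * ω ‖x + v‖) := by
      rw [← Real.exp_add]
      refine Real.exp_le_exp.2 ?_
      have := mul_le_mul_of_nonneg_left
        (h.le_of_le_add zero_le_one (norm_nonneg _) (norm_nonneg x) hx)
        (mul_pos two_pos hl).le
      linarith
    calc Real.exp (2 * l * ω ‖x‖) * ‖F (x + v)‖
        ≤ (Real.exp (2 * l * K * (1 + ω 1)) * Real.exp (2 * l * K * ω ‖x + v‖)) *
          ‖F (x + v)‖ := by gcongr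
      _ = Real.exp (2 * l * K * (1 + ω 1)) *
          (Real.exp (2 * l * K * ω ‖x + v‖) * ‖F (x + v)‖) := by ring
      _ ≤ _ := by gcongr; exact hC _
  set C₂ := Real.exp (2 * l * K * (1 + ω 1)) * (hF.exists_nonneg (2 * l * K)).choose
  have hC₂0 : 0 ≤ C₂ := mul_nonneg (Real.exp_pos _).le
    (hF.exists_nonneg (2 * l * K)).choose_spec.1
  refine ⟨C₂ + C₁ + M, fun x => ?_⟩
  -- The step length is `e = e^{-lω(x)} ≤ 1`. Both values of `F` are `O(e²)`, by decay at rate `2l`,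
  -- and the Taylor remainder is at most `M e²`; dividing the difference by `e` leaves a derivative
  -- of size `O(e)`.
  set e := Real.exp (-(l * ω ‖x‖)) with he
  have hωx := h.nonneg _ (norm_nonneg x)
  have he1 : e ≤ 1 := Real.exp_le_one_iff.2 (by nlinarith)
  have he0 : 0 < e := Real.exp_pos _
  have hexp : Real.exp (l * ω ‖x‖) = e⁻¹ := by rw [he, Real.exp_neg, inv_inv]
  have hexp2 : Real.exp (2 * l * ω ‖x‖) = e⁻¹ * e⁻¹ := by
    rw [← hexp, ← Real.exp_add]; ring_nf
  rw [hexp, inv_mul_le_iff₀ he0]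
  refine ContinuousLinearMap.opNorm_le_of_unit_norm (by positivity) fun v hv => ?_
  have hlip : ∀ y ∈ Metric.closedBall x e, ‖fderiv ℝ F y - fderiv ℝ F x‖ ≤ M * e := by
    intro y hy
    have := (convex_univ (𝕜 := ℝ) (E := V)).norm_image_sub_le_of_norm_fderiv_le
      (fun z _ => hd2 z) (fun z _ => hM z) (Set.mem_univ x) (Set.mem_univ y)
    refine this.trans ?_
    gcongr
    simpa [dist_eq_norm] using hy
  -- Mean value inequality for `F` minus its linearization at `x`, on the ball of radius `e`.
  have htaylor := (convex_closedBall x e).norm_image_sub_le_of_norm_fderiv_le'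
    (fun z _ => hd z) hlip (Metric.mem_closedBall_self he0.le)
    (y := x + e • v) (by simp [norm_smul, hv, abs_of_pos he0])
  rw [add_sub_cancel_left, map_smul, norm_smul, hv, mul_one, Real.norm_of_nonneg he0.le] at htaylor
  have hb1 : ‖F x‖ ≤ C₁ * (e * e) := by
    have := hC₁ x
    rw [hexp2, ← mul_inv, inv_mul_le_iff₀ (by positivity)] at this
    linarith
  have hb2 : ‖F (x + e • v)‖ ≤ C₂ * (e * e) := by
    have := hF2 (e • v) (by rw [norm_smul, hv, mul_one, Real.norm_of_nonneg he0.le]; exact he1) x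
    rw [hexp2, ← mul_inv, inv_mul_le_iff₀ (by positivity)] at this
    linarith
  have hfin : e * ‖fderiv ℝ F x v‖ ≤ e * (e * (C₂ + C₁ + M)) := by
    calc e * ‖fderiv ℝ F x v‖ = ‖e • fderiv ℝ F x v‖ := by
          rw [norm_smul, Real.norm_of_nonneg he0.le]
      _ = ‖F (x + e • v) - F x - (F (x + e • v) - F x - e • fderiv ℝ F x v)‖ := by
          congr 1; abel
      _ ≤ ‖F (x + e • v)‖ + ‖F x‖ + ‖F (x + e • v) - F x - e • fderiv ℝ F x v‖ :=
          (norm_sub_le _ _).trans (by gcongr; exact norm_sub_le _ _)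
      _ ≤ C₂ * (e * e) + C₁ * (e * e) + M * e * e := by gcongr
      _ = _ := by ring
  exact le_of_mul_le_mul_left hfin he0

/-- Induction: decay at order `n` and boundedness at order `n + 2` give decay at order `n + 1`. -/
theorem RapidDecay.iteratedFDeriv_of_bounded [NormedSpace ℝ V] [NormedSpace ℝ E]
    (h : IsWeightFunction ω K a b)
    {F : V → E} (hF : RapidDecay ω F) (hd : ContDiff ℝ (⊤ : ℕ∞) F)
    (hM : ∀ n, ∃ M : ℝ, ∀ x, ‖iteratedFDeriv ℝ n F x‖ ≤ M) (n : ℕ) :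
    RapidDecay ω (iteratedFDeriv ℝ n F) := by
  induction n with
  | zero =>
    intro l
    obtain ⟨C, hC⟩ := hF l
    exact ⟨C, fun x => by simpa using hC x⟩
  | succ n ih =>
    have hdiff : ∀ m : ℕ, Differentiable ℝ (iteratedFDeriv ℝ m F) := fun m =>
      hd.differentiable_iteratedFDeriv (by exact_mod_cast ENat.natCast_lt_top m)
    have hcd : ContDiff ℝ (⊤ : ℕ∞) (iteratedFDeriv ℝ n F) :=
      hd.iteratedFDeriv_right (by exact_mod_cast le_top)
    have hd2 : Differentiable ℝ (fderiv ℝ (iteratedFDeriv ℝ n F)) :=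
      (hcd.fderiv_right (m := (⊤ : ℕ∞)) (by exact_mod_cast le_top)).differentiable (by simp)
    obtain ⟨M, hM⟩ := hM (n + 2)
    refine (ih.fderiv_of_bounded h (hdiff n) hd2 (M := M) fun x => ?_).mono zero_le_one
      fun x => ?_
    · refine le_trans (le_of_eq ?_) (hM x)
      -- Currying is an isometry, so the second derivative of the `n`-th derivative has the norm of
      -- the derivative of order `n + 2`.
      rw [fderiv_iteratedFDeriv, ← norm_fderiv_iteratedFDeriv, LinearIsometryEquiv.comp_fderiv]
      exact LinearIsometry.norm_toContinuousLinearMap_comp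
        (LinearIsometryEquiv.toLinearIsometry _)
    · rw [one_mul, norm_fderiv_iteratedFDeriv]

end RapidDecay

/-! ### Membership in `𝒮_ω` from decay alone. -/

section UltraSchwartz

variable {V : Type*} [NormedAddCommGroup V] [InnerProductSpace ℝ V] [FiniteDimensional ℝ V]
  [MeasurableSpace V] [BorelSpace V] {ω : ℝ → ℝ} {K a b : ℝ}

theorem RapidDecay.integrable_pow_mul (h : IsWeightFunction ω K a b) {F : V → ℂ}
    (hF : RapidDecay ω F) (hc : Continuous F) (n : ℕ) :
    Integrable (fun x => ‖x‖ ^ n * ‖F x‖) volume := by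
  obtain ⟨C, l, hl, hC, hpow⟩ := h.pow_le n
  -- The weight `e^{(l+m)ω}` is split: `l` absorbs `‖x‖ ^ n`, and `m * b = d + 1` exceeds the
  -- dimension `d`, so `e^{-mω}` is integrable.
  set m : ℝ := (Module.finrank ℝ V + 1) / b with hm
  have hb := h.b_pos
  have hm0 : 0 ≤ m := by positivity
  obtain ⟨D, hD⟩ := hF (l + m)
  refine ((h.integrable_exp_neg (volume : Measure V) hm0 (by
    rw [hm, div_mul_cancel₀ _ hb.ne']; linarith)).const_mul (C * D)).mono'
    (by fun_prop) (Eventually.of_forall fun x => ?_)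
  rw [Real.norm_of_nonneg (by positivity)]
  have h1 : ‖F x‖ ≤ D * Real.exp (-(l * ω ‖x‖)) * Real.exp (-m * ω ‖x‖) := by
    have := hD x
    have h2 : Real.exp (-(l * ω ‖x‖)) * Real.exp (-m * ω ‖x‖) =
        (Real.exp ((l + m) * ω ‖x‖))⁻¹ := by
      rw [← Real.exp_add, ← Real.exp_neg]; ring_nf
    rw [mul_assoc, h2, ← div_eq_mul_inv, le_div_iff₀ (Real.exp_pos _)]
    linarith
  have hexp : Real.exp (l * ω ‖x‖) * Real.exp (-(l * ω ‖x‖)) = 1 := by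
    rw [← Real.exp_add, add_neg_cancel, Real.exp_zero]
  calc ‖x‖ ^ n * ‖F x‖ ≤ (C * Real.exp (l * ω ‖x‖)) *
        (D * Real.exp (-(l * ω ‖x‖)) * Real.exp (-m * ω ‖x‖)) := by
        gcongr
        exact hpow _ (norm_nonneg x)
    _ = C * D * Real.exp (-m * ω ‖x‖) *
        (Real.exp (l * ω ‖x‖) * Real.exp (-(l * ω ‖x‖))) := by ring
    _ = _ := by rw [hexp, mul_one]

theorem RapidDecay.integrable (h : IsWeightFunction ω K a b) {F : V → ℂ}
    (hF : RapidDecay ω F) (hc : Continuous F) : Integrable F volume := by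
  have := hF.integrable_pow_mul h hc 0
  simp only [pow_zero, one_mul] at this
  exact (integrable_norm_iff hc.aestronglyMeasurable).1 this

theorem contDiff_fourierHat {F : V → ℂ}
    (hF : ∀ n : ℕ, Integrable (fun x => ‖x‖ ^ n * ‖F x‖) volume) :
    ContDiff ℝ (⊤ : ℕ∞) (fourierHat F) := by
  rw [fourierHat_eq_fourierIntegral]
  exact VectorFourier.contDiff_fourierIntegral _ fun n _ => hF n

theorem norm_iteratedFDeriv_fourierHat_le {F : V → ℂ} (hc : Continuous F)
    (hF : ∀ n : ℕ, Integrable (fun x => ‖x‖ ^ n * ‖F x‖) volume) (n : ℕ) (ξ : V) :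
    ‖iteratedFDeriv ℝ n (fourierHat F) ξ‖ ≤
      ∫ x, (2 * Real.pi * ‖fourierForm V‖) ^ n * (‖x‖ ^ n * ‖F x‖) := by
  rw [fourierHat_eq_fourierIntegral, VectorFourier.iteratedFDeriv_fourierIntegral
    (N := ⊤) _ (fun n _ => hF n) hc.aestronglyMeasurable (by exact_mod_cast le_top)]
  refine (VectorFourier.norm_fourierIntegral_le_integral_norm _ _ _ _ _).trans ?_
  refine integral_mono_of_nonneg (Eventually.of_forall fun x => norm_nonneg _)
    ((hF n).const_mul _) (Eventually.of_forall fun x => ?_)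
  refine (VectorFourier.norm_fourierPowSMulRight_le _ _ _ _).trans (le_of_eq ?_)
  ring

/-- Finite moments of `F` bound all derivatives of its transform, and interpolation upgrades
boundedness to decay. -/
theorem RapidDecay.derivSup_fourierHat_lt_top (h : IsWeightFunction ω K a b) {F : V → ℂ}
    (hc : Continuous F) (hF : RapidDecay ω F) (hF' : RapidDecay ω (fourierHat F)) (l : ℝ) (n : ℕ) :
    derivSup ω l n (fourierHat F) < ∞ := by
  have hmom := hF.integrable_pow_mul h hc
  obtain ⟨C, hC⟩ := hF'.iteratedFDeriv_of_bounded h (contDiff_fourierHat hmom)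
    (fun n => ⟨_, norm_iteratedFDeriv_fourierHat_le hc hmom n⟩) n l
  exact (iSup_le fun x => ENNReal.ofReal_le_ofReal (hC x)).trans_lt ENNReal.ofReal_lt_top

/-- A continuous function belongs to `𝒮_ω` as soon as it and its Fourier transform decay faster than
every `e^{-lω}`. -/
theorem mem_ultraSchwartz_of_rapidDecay (h : IsWeightFunction ω K a b) {F : V → ℂ}
    (hc : Continuous F) (hF : RapidDecay ω F) (hF' : RapidDecay ω (fourierHat F)) :
    F ∈ ultraSchwartz V ω := by
  have hint := hF.integrable h hc
  have hc' := continuous_fourierHat hint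
  have hint' := hF'.integrable h hc'
  -- `G` is the inverse Fourier transform of `F`. Writing `F` as the transform of `G` lets the same
  -- lemma treat the derivatives of `F` and of its transform.
  set G : V → ℂ := fun ξ => ((fourierConst V : ℝ) : ℂ)⁻¹ * fourierHat F (-ξ) with hG
  have hconst : ((fourierConst V : ℝ) : ℂ) ≠ 0 := by exact_mod_cast (fourierConst_pos V).ne'
  have hGF : fourierHat G = F := by
    funext x
    have h1 := fourierHat_smul ((fourierConst V : ℝ) : ℂ)⁻¹ (fun ξ => fourierHat F (-ξ))
    have h2 : G = ((fourierConst V : ℝ) : ℂ)⁻¹ • fun ξ => fourierHat F (-ξ) := rfl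
    rw [h2, h1, Pi.smul_apply, fourierHat_comp_neg, fourierHat_fourierHat hc hint hint', neg_neg,
      smul_eq_mul]
    exact inv_mul_cancel_left₀ hconst _
  have hGc : Continuous G := by fun_prop
  have hGd : RapidDecay ω G := by
    intro l
    obtain ⟨C, hC⟩ := hF' l
    refine ⟨‖((fourierConst V : ℝ) : ℂ)⁻¹‖ * C, fun x => ?_⟩
    have := hC (-x)
    rw [norm_neg] at this
    rw [hG, norm_mul, mul_left_comm]
    gcongr
  refine ⟨hint, ?_, contDiff_fourierHat (hF.integrable_pow_mul h hc), fun l _ n => ⟨?_, ?_⟩⟩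
  · rw [← hGF]
    exact contDiff_fourierHat (hGd.integrable_pow_mul h hGc)
  · rw [← hGF]
    exact hGd.derivSup_fourierHat_lt_top h hGc (hGF.symm ▸ hF) l n
  · exact hF.derivSup_fourierHat_lt_top h hc hF' l n

theorem rapidDecay_of_derivSup_lt_top (h : IsWeightFunction ω K a b) {F : V → ℂ}
    (hF : ∀ l : ℝ, 0 < l → derivSup ω l 0 F < ∞) : RapidDecay ω F := by
  refine h.rapidDecay_of_pos fun l hl => ⟨(derivSup ω l 0 F).toReal, fun x => ?_⟩
  rw [← ENNReal.ofReal_le_iff_le_toReal (hF l hl).ne]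
  have := le_iSup (fun x => ENNReal.ofReal (Real.exp (l * ω ‖x‖) * ‖iteratedFDeriv ℝ 0 F x‖)) x
  simpa [derivSup] using this

variable {f : V → ℂ}

theorem rapidDecay_of_mem_ultraSchwartz (h : IsWeightFunction ω K a b)
    (hf : f ∈ ultraSchwartz V ω) : RapidDecay ω f :=
  rapidDecay_of_derivSup_lt_top h fun l hl => (hf.2.2.2 l hl 0).1

theorem rapidDecay_fourierHat_of_mem_ultraSchwartz (h : IsWeightFunction ω K a b)
    (hf : f ∈ ultraSchwartz V ω) : RapidDecay ω (fourierHat f) :=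
  rapidDecay_of_derivSup_lt_top h fun l hl => (hf.2.2.2 l hl 0).2

theorem fourierInvertible_of_mem_ultraSchwartz (h : IsWeightFunction ω K a b)
    (hf : f ∈ ultraSchwartz V ω) : FourierInvertible f where
  continuous := hf.2.1.continuous
  integrable := hf.1
  integrable_hat := (rapidDecay_fourierHat_of_mem_ultraSchwartz h hf).integrable h
    hf.2.2.1.continuous

theorem weightedNorm_top_lt_top_of_rapidDecay (hf : RapidDecay ω f) (l : ℝ) :
    weightedNorm ω ∞ l f < ∞ := by
  obtain ⟨C, hC⟩ := hf l
  refine (weightedNorm_top_le (B := ENNReal.ofReal C) fun x => ?_).trans_lt ENNReal.ofReal_lt_top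
  rw [expWeight, ← ofReal_norm, ← ENNReal.ofReal_mul (Real.exp_pos _).le]
  exact ENNReal.ofReal_le_ofReal (hC x)

theorem fourierHat_comp_sub (F : V → ℂ) (z ξ : V) :
    fourierHat (fun w => F (z - w)) ξ =
      Complex.exp (Complex.I * (inner ℝ z (-ξ) : ℝ)) * fourierHat F (-ξ) := by
  have := fourierHat_comp_neg (fun w => F (z + w)) ξ
  simp only [← sub_eq_add_neg] at this
  rw [this, fourierHat_translate]

theorem comp_sub_mem_ultraSchwartz (h : IsWeightFunction ω K a b) (hf : f ∈ ultraSchwartz V ω)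
    (z : V) : (fun w => f (z - w)) ∈ ultraSchwartz V ω := by
  refine mem_ultraSchwartz_of_rapidDecay h (hf.2.1.continuous.comp (by fun_prop)) ?_ ?_
  · refine (rapidDecay_of_mem_ultraSchwartz h hf).comp_of_le_add h (A := fun w => z - w)
      (norm_nonneg z) fun w => ?_
    calc ‖w‖ = ‖z - (z - w)‖ := by rw [sub_sub_cancel]
      _ ≤ _ := norm_sub_le _ _
  · have h1 := (rapidDecay_fourierHat_of_mem_ultraSchwartz h hf).comp_of_le_two_mul h
      (A := fun ξ : V => -ξ) fun ξ => by rw [norm_neg]; linarith [norm_nonneg ξ]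
    refine h1.mono zero_le_one fun ξ => ?_
    rw [fourierHat_comp_sub, norm_mul, mul_comm Complex.I, Complex.norm_exp_ofReal_mul_I]
    rfl

end UltraSchwartz

/-! ### Pointwise bounds of the cross-Wigner transform by Rihaczek forms. -/

section CrossWigner

variable {V : Type*} [NormedAddCommGroup V] [InnerProductSpace ℝ V] [FiniteDimensional ℝ V]
  [MeasurableSpace V] [BorelSpace V] {ω : ℝ → ℝ} {K a b : ℝ}

theorem lintegral_withLp_prod {F : WithLp 2 (V × V) → ℝ≥0∞} (hF : Measurable F) :
    ∫⁻ z, F z = ∫⁻ x, ∫⁻ y, F (WithLp.toLp 2 (x, y)) := by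
  have hmp := WithLp.volume_preserving_toLp V V
  rw [← hmp.lintegral_comp hF, Measure.volume_eq_prod,
    lintegral_prod (fun z => F (WithLp.toLp 2 z)) (hF.comp hmp.measurable).aemeasurable]

theorem integrable_withLp_prod_iff {F : WithLp 2 (V × V) → ℂ} :
    Integrable (fun z : V × V => F (WithLp.toLp 2 z)) volume ↔ Integrable F volume :=
  (WithLp.volume_preserving_toLp V V).integrable_comp_emb
    (MeasurableEquiv.toLp 2 (V × V)).measurableEmbedding

theorem integral_withLp_prod {F : WithLp 2 (V × V) → ℂ} (hF : Integrable F volume) :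
    ∫ z, F z = ∫ x, ∫ y, F (WithLp.toLp 2 (x, y)) := by
  have h1 := (WithLp.volume_preserving_toLp V V).integral_comp
    (MeasurableEquiv.toLp 2 (V × V)).measurableEmbedding F
  rw [← h1, Measure.volume_eq_prod]
  exact integral_prod _ (integrable_withLp_prod_iff.2 hF)

theorem finrank_withLp_prod : Module.finrank ℝ (WithLp 2 (V × V)) = 2 * Module.finrank ℝ V := by
  rw [(WithLp.linearEquiv 2 ℝ (V × V)).finrank_eq, Module.finrank_prod, two_mul]

/-- The cross-Wigner transform of `f` and `h`. -/
noncomputable def crossWigner (f h : V → ℂ) (z : WithLp 2 (V × V)) : ℂ :=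
  ∫ t : V, Complex.exp (-(Complex.I * (inner ℝ t z.snd : ℝ))) *
    f (z.fst + (1 / 2 : ℝ) • t) * (starRingEnd ℂ) (h (z.fst - (1 / 2 : ℝ) • t))

/-- The tensor product of `f` and `f̂` up to phase and conjugation, i.e. the Rihaczek form. -/
noncomputable def rihaczekForm (f : V → ℂ) (z : WithLp 2 (V × V)) : ℂ :=
  Complex.exp (-(Complex.I * (inner ℝ z.fst z.snd : ℝ))) * f z.fst *
    (starRingEnd ℂ) (fourierHat f z.snd)

theorem enorm_rihaczekForm (f : V → ℂ) (z : WithLp 2 (V × V)) :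
    ‖rihaczekForm f z‖ₑ = ‖f z.fst‖ₑ * ‖fourierHat f z.snd‖ₑ := by
  rw [rihaczekForm, enorm_mul, enorm_mul, enorm_exp_neg_I_mul, one_mul, enorm_conj]

theorem FourierInvertible.continuous_rihaczekForm {f : V → ℂ} (hf : FourierInvertible f) :
    Continuous (rihaczekForm f) := by
  have h1 := hf.continuous
  have h2 := hf.continuous_hat
  have h3 : Continuous fun z : WithLp 2 (V × V) => (starRingEnd ℂ) (fourierHat f z.snd) :=
    Complex.continuous_conj.comp (h2.comp (by fun_prop))
  unfold rihaczekForm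
  fun_prop

theorem abs_half_pow_inv (d : ℕ) : |((1 / 2 : ℝ) ^ d)⁻¹| = 2 ^ d := by
  rw [one_div, inv_pow, inv_inv, abs_of_pos (by positivity)]

theorem abs_neg_half_pow_inv (d : ℕ) : |((-(1 / 2) : ℝ) ^ d)⁻¹| = 2 ^ d := by
  rw [abs_inv, abs_pow, abs_neg, ← abs_pow, ← abs_inv, abs_half_pow_inv]

/-- Take absolute values and substitute `u = x + t/2`, so that `x - t/2 = 2x - u` and `dt = 2^d du`.
-/
theorem enorm_crossWigner_le {f h : V → ℂ} (z : WithLp 2 (V × V)) :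
    ‖crossWigner f h z‖ₑ ≤ ENNReal.ofReal (2 ^ Module.finrank ℝ V) *
      ∫⁻ u, ‖f u‖ₑ * ‖h ((2 : ℝ) • z.fst - u)‖ₑ := by
  refine (enorm_integral_le_lintegral_enorm _).trans (le_of_eq ?_)
  have h1 := lintegral_comp_smul (V := V)
    (fun s => ‖f (z.fst + s)‖ₑ * ‖h (z.fst - s)‖ₑ) (r := 1 / 2) (by norm_num)
  rw [abs_half_pow_inv] at h1
  rw [← lintegral_add_left_eq_self (fun u => ‖f u‖ₑ * ‖h ((2 : ℝ) • z.fst - u)‖ₑ) z.fst]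
  simp only [enorm_mul, enorm_exp_neg_I_mul, enorm_conj, one_mul]
  rw [h1]
  refine congrArg _ (lintegral_congr fun s => ?_)
  rw [two_smul, add_sub_add_left_eq_sub]

theorem enorm_fourierHat_dilate_translate (f : V → ℂ) (x : V) {r : ℝ} (hr : r ≠ 0) (ξ : V) :
    ‖fourierHat (fun t => f (x + r • t)) ξ‖ₑ =
      ENNReal.ofReal |(r ^ Module.finrank ℝ V)⁻¹| * ‖fourierHat f (r⁻¹ • ξ)‖ₑ := by
  rw [fourierHat_dilate (fun y => f (x + y)) hr, fourierHat_translate, enorm_mul, enorm_mul,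
    ← ofReal_norm, Complex.norm_real, Real.norm_eq_abs, abs_abs, ← ofReal_norm (Complex.exp _),
    mul_comm Complex.I, Complex.norm_exp_ofReal_mul_I, ENNReal.ofReal_one, one_mul]

/-- Parseval in `t` gives the mirror image of `enorm_crossWigner_le` on the frequency side:
modulation by `ξ` shifts the transform, and each dilation by `1/2` contributes `2^d`. -/
theorem enorm_crossWigner_le_fourierHat {f h : V → ℂ} (hf : FourierInvertible f)
    (hh : FourierInvertible h) (z : WithLp 2 (V × V)) :
    ENNReal.ofReal (fourierConst V) * ‖crossWigner f h z‖ₑ ≤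
      ENNReal.ofReal (2 ^ Module.finrank ℝ V) *
        ∫⁻ v, ‖fourierHat f v‖ₑ * ‖fourierHat h ((2 : ℝ) • z.snd - v)‖ₑ := by
  have h2 : (1 / 2 : ℝ) ≠ 0 := by norm_num
  have h2' : (-(1 / 2) : ℝ) ≠ 0 := by norm_num
  have hF : FourierInvertible fun t => Complex.exp (-(Complex.I * (inner ℝ t z.snd : ℝ))) *
      f (z.fst + (1 / 2 : ℝ) • t) := ((hf.translate z.fst).dilate h2).modulate z.snd
  have hG : FourierInvertible fun t => h (z.fst + (-(1 / 2) : ℝ) • t) :=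
    (hh.translate z.fst).dilate h2'
  have key := enorm_integral_mul_conj_le hF hG.integrable
  have heq : crossWigner f h z = ∫ t, (Complex.exp (-(Complex.I * (inner ℝ t z.snd : ℝ))) *
      f (z.fst + (1 / 2 : ℝ) • t)) * (starRingEnd ℂ) (h (z.fst + (-(1 / 2) : ℝ) • t)) := by
    simp only [crossWigner, neg_smul, sub_eq_add_neg]
  rw [heq]
  refine key.trans (le_of_eq ?_)
  have h3 : ∀ η : V, ‖fourierHat (fun t => Complex.exp (-(Complex.I * (inner ℝ t z.snd : ℝ))) *
      f (z.fst + (1 / 2 : ℝ) • t)) η‖ₑ *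
        ‖fourierHat (fun t => h (z.fst + (-(1 / 2) : ℝ) • t)) η‖ₑ =
      (ENNReal.ofReal (2 ^ Module.finrank ℝ V) * ENNReal.ofReal (2 ^ Module.finrank ℝ V)) *
        (‖fourierHat f ((2 : ℝ) • z.snd + (2 : ℝ) • η)‖ₑ * ‖fourierHat h (-((2 : ℝ) • η))‖ₑ) := by
    intro η
    rw [fourierHat_modulate (fun t => f (z.fst + (1 / 2 : ℝ) • t)),
      enorm_fourierHat_dilate_translate f _ h2, enorm_fourierHat_dilate_translate h _ h2',
      abs_half_pow_inv, abs_neg_half_pow_inv]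
    have e1 : (1 / 2 : ℝ)⁻¹ • (η + z.snd) = (2 : ℝ) • z.snd + (2 : ℝ) • η := by
      rw [← smul_add, add_comm]; norm_num
    have e2 : (-(1 / 2) : ℝ)⁻¹ • η = -((2 : ℝ) • η) := by
      rw [← neg_smul]; norm_num
    rw [e1, e2]
    ring
  rw [lintegral_congr h3, lintegral_const_mul' _ _ (by simp [ENNReal.mul_eq_top])]
  -- The substitution `s = 2η` cancels one of the two factors `2^d`.
  have h4 := lintegral_comp_smul (V := V)
    (fun s => ‖fourierHat f ((2 : ℝ) • z.snd + s)‖ₑ * ‖fourierHat h (-s)‖ₑ) (r := 2) (by norm_num)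
  rw [h4, ← lintegral_add_left_eq_self
      (fun v => ‖fourierHat f v‖ₑ * ‖fourierHat h ((2 : ℝ) • z.snd - v)‖ₑ) ((2 : ℝ) • z.snd),
    ← mul_assoc, mul_assoc _ _ (ENNReal.ofReal |_|),
    ← ENNReal.ofReal_mul (p := 2 ^ _) (by positivity), abs_of_pos (by positivity),
    mul_inv_cancel₀ (by positivity), ENNReal.ofReal_one, mul_one]
  refine congrArg _ (lintegral_congr fun s => ?_)
  rw [sub_add_cancel_left]

/-- Multiply the position bound by the frequency bound. The modulus of the Rihaczek form is a tensor
product, so by Tonelli the product of the two convolutions is one convolution on phase space,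
evaluated at `2z`. -/
theorem enorm_crossWigner_sq_le {f h : V → ℂ} (hf : FourierInvertible f)
    (hh : FourierInvertible h) (z : WithLp 2 (V × V)) :
    ‖crossWigner f h z‖ₑ ^ 2 ≤ ENNReal.ofReal ((4 / (2 * Real.pi)) ^ Module.finrank ℝ V) *
      ∫⁻ w, ‖rihaczekForm f w‖ₑ * ‖rihaczekForm h ((2 : ℝ) • z - w)‖ₑ := by
  have hcf := hf.continuous
  have hch := hh.continuous
  have hcf' := hf.continuous_hat
  have hch' := hh.continuous_hat
  have h1 := mul_le_mul' (enorm_crossWigner_le (f := f) (h := h) z)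
    (enorm_crossWigner_le_fourierHat hf hh z)
  have hprod : ∫⁻ w, ‖rihaczekForm f w‖ₑ * ‖rihaczekForm h ((2 : ℝ) • z - w)‖ₑ =
      (∫⁻ u, ‖f u‖ₑ * ‖h ((2 : ℝ) • z.fst - u)‖ₑ) *
        ∫⁻ v, ‖fourierHat f v‖ₑ * ‖fourierHat h ((2 : ℝ) • z.snd - v)‖ₑ := by
    have m1 : Measurable fun u => ‖f u‖ₑ * ‖h ((2 : ℝ) • z.fst - u)‖ₑ :=
      by fun_prop
    have m2 : Measurable fun v => ‖fourierHat f v‖ₑ * ‖fourierHat h ((2 : ℝ) • z.snd - v)‖ₑ :=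
      by fun_prop
    have m3 : Measurable fun w => ‖rihaczekForm f w‖ₑ * ‖rihaczekForm h ((2 : ℝ) • z - w)‖ₑ := by
      have := hf.continuous_rihaczekForm
      have := hh.continuous_rihaczekForm
      fun_prop
    rw [lintegral_withLp_prod m3, ← lintegral_mul_const _ m1]
    refine lintegral_congr fun u => ?_
    rw [← lintegral_const_mul _ m2]
    refine lintegral_congr fun v => ?_
    simp only [enorm_rihaczekForm, WithLp.sub_fst, WithLp.sub_snd, WithLp.smul_fst,
      WithLp.smul_snd, WithLp.toLp_fst, WithLp.toLp_snd]
    ring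
  rw [hprod]
  have hc0 : ENNReal.ofReal (fourierConst V) ≠ 0 := by simpa using fourierConst_pos V
  have hconst : ENNReal.ofReal (fourierConst V) *
      ENNReal.ofReal ((4 / (2 * Real.pi)) ^ Module.finrank ℝ V) =
      ENNReal.ofReal (2 ^ Module.finrank ℝ V) * ENNReal.ofReal (2 ^ Module.finrank ℝ V) := by
    rw [← ENNReal.ofReal_mul (fourierConst_pos V).le, ← ENNReal.ofReal_mul (by positivity),
      fourierConst, ← mul_pow, ← mul_pow, mul_div_cancel₀ _ (by positivity)]
    norm_num
  refine (ENNReal.mul_le_mul_iff_right hc0 ENNReal.ofReal_ne_top).1 ?_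
  calc ENNReal.ofReal (fourierConst V) * ‖crossWigner f h z‖ₑ ^ 2
      = ‖crossWigner f h z‖ₑ * (ENNReal.ofReal (fourierConst V) * ‖crossWigner f h z‖ₑ) := by ring
    _ ≤ _ := h1
    _ = (ENNReal.ofReal (2 ^ Module.finrank ℝ V) * ENNReal.ofReal (2 ^ Module.finrank ℝ V)) *
        ((∫⁻ u, ‖f u‖ₑ * ‖h ((2 : ℝ) • z.fst - u)‖ₑ) *
        ∫⁻ v, ‖fourierHat f v‖ₑ * ‖fourierHat h ((2 : ℝ) • z.snd - v)‖ₑ) := by ring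
    _ = _ := by rw [← hconst]; ring

theorem weightedNorm_top_sq_le {G : Type*} [NormedAddCommGroup G] [NormedSpace ℝ G]
    {l : ℝ} {F : V → G} {B : ℝ≥0∞} (hF : ∀ x, (expWeight ω l x * ‖F x‖ₑ) ^ 2 ≤ B) :
    weightedNorm ω ∞ l F ^ 2 ≤ B := by
  have h1 : weightedNorm ω ∞ l F ≤ B ^ (1 / 2 : ℝ) := by
    refine weightedNorm_top_le fun x => ?_
    rw [one_div, ENNReal.le_rpow_inv_iff (by norm_num)]
    exact_mod_cast hF x
  calc weightedNorm ω ∞ l F ^ 2 ≤ (B ^ (1 / 2 : ℝ)) ^ 2 := by gcongr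
    _ = B := by rw [← ENNReal.rpow_natCast, ← ENNReal.rpow_mul]; norm_num

/-- The points `w` and `2z - w` have midpoint `z`, so `e^{2lω(z)}` is distributed over the two
factors without loss before Hölder. -/
theorem IsWeightFunction.weighted_crossWigner_sq_le (hω : IsWeightFunction ω K a b) (p q : ℝ≥0∞)
    [p.HolderConjugate q] {f h : V → ℂ} (hf : FourierInvertible f) (hh : FourierInvertible h)
    {l : ℝ} (hl : 0 ≤ l) (z : WithLp 2 (V × V)) :
    (expWeight ω l z * ‖crossWigner f h z‖ₑ) ^ 2 ≤
      ENNReal.ofReal ((4 / (2 * Real.pi)) ^ Module.finrank ℝ V) *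
        (weightedNorm ω p (2 * l) (rihaczekForm f) *
          weightedNorm ω q (2 * l) (rihaczekForm h)) := by
  have h1 := hω.lintegral_weighted_mul_comp_sub_le p q (2 * l) (2 * l)
    hf.continuous_rihaczekForm.aestronglyMeasurable
    hh.continuous_rihaczekForm.aestronglyMeasurable ((2 : ℝ) • z)
  rw [mul_pow, pow_two (expWeight ω l z), ← expWeight_add, ← two_mul]
  calc expWeight ω (2 * l) z * ‖crossWigner f h z‖ₑ ^ 2
      ≤ expWeight ω (2 * l) z * (ENNReal.ofReal ((4 / (2 * Real.pi)) ^ Module.finrank ℝ V) *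
        ∫⁻ w, ‖rihaczekForm f w‖ₑ * ‖rihaczekForm h ((2 : ℝ) • z - w)‖ₑ) := by
        gcongr
        exact enorm_crossWigner_sq_le hf hh z
    _ = ENNReal.ofReal ((4 / (2 * Real.pi)) ^ Module.finrank ℝ V) * ∫⁻ w, expWeight ω (2 * l) z *
        (‖rihaczekForm f w‖ₑ * ‖rihaczekForm h ((2 : ℝ) • z - w)‖ₑ) := by
        rw [lintegral_const_mul' _ _ (expWeight_ne_top _ _)]; ring
    _ ≤ _ := by
        gcongr
        refine (lintegral_mono fun w => ?_).trans h1
        have := hω.expWeight_le_mul_of_midpoint (mul_nonneg zero_le_two hl) z w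
        calc _ ≤ (expWeight ω (2 * l) w * expWeight ω (2 * l) ((2 : ℝ) • z - w)) *
              (‖rihaczekForm f w‖ₑ * ‖rihaczekForm h ((2 : ℝ) • z - w)‖ₑ) := by gcongr
          _ = _ := by ring

end CrossWigner

/-! ### The Wigner transform maps `𝒮_ω` into `𝒮_ω`. -/

section WignerMembership

variable {V : Type*} [NormedAddCommGroup V] [InnerProductSpace ℝ V] [FiniteDimensional ℝ V]
  [MeasurableSpace V] [BorelSpace V] {ω : ℝ → ℝ} {K a b : ℝ}

theorem norm_le_add_withLp (z : WithLp 2 (V × V)) : ‖z‖ ≤ ‖z.fst‖ + ‖z.snd‖ := by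
  rw [WithLp.prod_norm_eq_of_L2]
  refine Real.sqrt_le_iff.2 ⟨by positivity, ?_⟩
  nlinarith [mul_nonneg (norm_nonneg z.fst) (norm_nonneg z.snd)]

theorem RapidDecay.rihaczekForm (hω : IsWeightFunction ω K a b) {f : V → ℂ} (hf : RapidDecay ω f)
    (hf' : RapidDecay ω (fourierHat f)) : RapidDecay ω (rihaczekForm f) := by
  refine hω.rapidDecay_of_pos fun l hl => ?_
  obtain ⟨C, hC0, hC⟩ := hf.exists_nonneg (l * K)
  obtain ⟨D, hD0, hD⟩ := hf'.exists_nonneg (l * K)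
  refine ⟨Real.exp (l * K) * (C * D), fun z => ?_⟩
  have h1 : Real.exp (l * ω ‖z‖) ≤ Real.exp (l * K) *
      (Real.exp (l * K * ω ‖z.fst‖) * Real.exp (l * K * ω ‖z.snd‖)) := by
    rw [← Real.exp_add, ← Real.exp_add]
    refine Real.exp_le_exp.2 ?_
    have := mul_le_mul_of_nonneg_left (hω.le_of_le_add (norm_nonneg z.fst) (norm_nonneg z.snd)
      (norm_nonneg z) (norm_le_add_withLp z)) hl.le
    linarith
  have h2 : ‖_root_.rihaczekForm f z‖ = ‖f z.fst‖ * ‖fourierHat f z.snd‖ := by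
    rw [_root_.rihaczekForm, norm_mul, norm_mul, norm_exp_neg_I_mul, one_mul, RCLike.norm_conj]
  rw [h2]
  calc Real.exp (l * ω ‖z‖) * (‖f z.fst‖ * ‖fourierHat f z.snd‖)
      ≤ (Real.exp (l * K) * (Real.exp (l * K * ω ‖z.fst‖) * Real.exp (l * K * ω ‖z.snd‖))) *
        (‖f z.fst‖ * ‖fourierHat f z.snd‖) := by gcongr
    _ = Real.exp (l * K) * ((Real.exp (l * K * ω ‖z.fst‖) * ‖f z.fst‖) *
        (Real.exp (l * K * ω ‖z.snd‖) * ‖fourierHat f z.snd‖)) := by ring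
    _ ≤ _ := by
      gcongr
      · exact hC _
      · exact hD _

theorem weightedNorm_one_lt_top_of_rapidDecay (hω : IsWeightFunction ω K a b) {F : V → ℂ}
    (hF : RapidDecay ω F) (hc : Continuous F) (l : ℝ) : weightedNorm ω 1 l F < ∞ := by
  set m : ℝ := (Module.finrank ℝ V + 1) / b with hm
  have hb := hω.b_pos
  have hm0 : 0 ≤ m := by positivity
  refine (hω.weightedNorm_le_mul 1 ∞ 1 m l hc.aestronglyMeasurable).trans_lt (ENNReal.mul_lt_top
    (hω.weightedNorm_exp_neg_lt_top le_rfl ENNReal.one_ne_top hm0 ?_)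
    (weightedNorm_top_lt_top_of_rapidDecay hF _))
  rw [ENNReal.toReal_one, mul_one, hm, div_mul_cancel₀ _ hb.ne']
  linarith

/-- The weighted square bound with exponents `1` and `∞`, both norms being finite for rapidly
decaying data. -/
theorem RapidDecay.crossWigner (hω : IsWeightFunction ω K a b) {f h : V → ℂ}
    (hf : FourierInvertible f) (hfd : RapidDecay ω f) (hfd' : RapidDecay ω (fourierHat f))
    (hh : FourierInvertible h) (hhd : RapidDecay ω h) (hhd' : RapidDecay ω (fourierHat h)) :
    RapidDecay ω (crossWigner f h) := by
  refine hω.rapidDecay_of_pos fun l hl => ?_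
  set B := ENNReal.ofReal ((4 / (2 * Real.pi)) ^ Module.finrank ℝ V) *
        (weightedNorm ω 1 (2 * l) (_root_.rihaczekForm f) *
          weightedNorm ω ∞ (2 * l) (_root_.rihaczekForm h)) with hB
  have hBtop : B < ∞ := ENNReal.mul_lt_top ENNReal.ofReal_lt_top (ENNReal.mul_lt_top
    (weightedNorm_one_lt_top_of_rapidDecay hω (hfd.rihaczekForm hω hfd')
      hf.continuous_rihaczekForm _)
    (weightedNorm_top_lt_top_of_rapidDecay (hhd.rihaczekForm hω hhd') _))
  refine ⟨Real.sqrt B.toReal, fun z => Real.le_sqrt_of_sq_le ?_⟩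
  rw [← ENNReal.ofReal_le_iff_le_toReal hBtop.ne, ENNReal.ofReal_pow (by positivity),
    ENNReal.ofReal_mul (Real.exp_pos _).le, ofReal_norm]
  exact hω.weighted_crossWigner_sq_le 1 ∞ hf hh hl.le z

theorem norm_half_smul_le_max (x t : V) :
    ‖(1 / 2 : ℝ) • t‖ ≤ max ‖x + (1 / 2 : ℝ) • t‖ ‖x - (1 / 2 : ℝ) • t‖ := by
  have h1 : (1 / 2 : ℝ) • t + (1 / 2 : ℝ) • t =
      (x + (1 / 2 : ℝ) • t) - (x - (1 / 2 : ℝ) • t) := by abel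
  have h2 := norm_sub_le (x + (1 / 2 : ℝ) • t) (x - (1 / 2 : ℝ) • t)
  rw [← h1, ← two_smul ℝ, norm_smul, Real.norm_two] at h2
  linarith [le_max_left ‖x + (1 / 2 : ℝ) • t‖ ‖x - (1 / 2 : ℝ) • t‖,
    le_max_right ‖x + (1 / 2 : ℝ) • t‖ ‖x - (1 / 2 : ℝ) • t‖]

theorem RapidDecay.norm_mul_norm_le (hω : IsWeightFunction ω K a b) {f h : V → ℂ}
    (hf : RapidDecay ω f) (hh : RapidDecay ω h) {l : ℝ} (hl : 0 ≤ l) :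
    ∃ C, ∀ x t : V, ‖f (x + (1 / 2 : ℝ) • t)‖ * ‖h (x - (1 / 2 : ℝ) • t)‖ ≤
      C * Real.exp (-l * ω ‖(1 / 2 : ℝ) • t‖) := by
  obtain ⟨C, hC0, hC⟩ := hf.exists_nonneg l
  obtain ⟨D, hD0, hD⟩ := hh.exists_nonneg l
  refine ⟨C * D, fun x t => ?_⟩
  have h1 := hω.le_of_le_max (norm_nonneg _) (norm_nonneg _) (norm_nonneg _)
    (norm_half_smul_le_max x t)
  have h2 : Real.exp (l * ω ‖(1 / 2 : ℝ) • t‖) ≤ Real.exp (l * ω ‖x + (1 / 2 : ℝ) • t‖) *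
      Real.exp (l * ω ‖x - (1 / 2 : ℝ) • t‖) := by
    rw [← Real.exp_add, ← mul_add]
    gcongr
  rw [neg_mul, Real.exp_neg, ← div_eq_mul_inv, le_div_iff₀ (Real.exp_pos _)]
  calc _ ≤ ‖f (x + (1 / 2 : ℝ) • t)‖ * ‖h (x - (1 / 2 : ℝ) • t)‖ *
        (Real.exp (l * ω ‖x + (1 / 2 : ℝ) • t‖) * Real.exp (l * ω ‖x - (1 / 2 : ℝ) • t‖)) := by
        gcongr
    _ = (Real.exp (l * ω ‖x + (1 / 2 : ℝ) • t‖) * ‖f (x + (1 / 2 : ℝ) • t)‖) *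
        (Real.exp (l * ω ‖x - (1 / 2 : ℝ) • t‖) * ‖h (x - (1 / 2 : ℝ) • t)‖) := by ring
    _ ≤ _ := by
      gcongr
      · exact hC _
      · exact hD _

/-- Half of `t` is no longer than the longer of `x ± t/2`, so one factor always decays in `t`. The
majorant does not depend on `x`, as dominated convergence requires. -/
theorem exists_integrable_bound_mul (hω : IsWeightFunction ω K a b) {f h : V → ℂ}
    (hf : RapidDecay ω f) (hh : RapidDecay ω h) :
    ∃ φ : V → ℝ, Integrable φ volume ∧
      ∀ x t : V, ‖f (x + (1 / 2 : ℝ) • t)‖ * ‖h (x - (1 / 2 : ℝ) • t)‖ ≤ φ t := by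
  set m : ℝ := (Module.finrank ℝ V + 1) / b with hm
  have hb := hω.b_pos
  have hm0 : 0 ≤ m := by positivity
  obtain ⟨C, hC⟩ := hf.norm_mul_norm_le hω hh hm0
  refine ⟨_, ?_, hC⟩
  refine Integrable.const_mul ?_ C
  exact (hω.integrable_exp_neg (volume : Measure V) hm0 (by
    rw [hm, div_mul_cancel₀ _ hb.ne']; linarith)).comp_smul (by norm_num : (1 / 2 : ℝ) ≠ 0)

theorem continuous_crossWigner (hω : IsWeightFunction ω K a b) {f h : V → ℂ} (hfc : Continuous f)
    (hf : RapidDecay ω f) (hhc : Continuous h) (hh : RapidDecay ω h) :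
    Continuous (crossWigner f h) := by
  obtain ⟨φ, hφ, hle⟩ := exists_integrable_bound_mul hω hf hh
  refine continuous_of_dominated (bound := φ) (fun z => ?_)
    (fun z => Eventually.of_forall fun t => ?_) hφ (Eventually.of_forall fun t => ?_)
  · have : Continuous fun t => (starRingEnd ℂ) (h (z.fst - (1 / 2 : ℝ) • t)) :=
      Complex.continuous_conj.comp (by fun_prop)
    exact Continuous.aestronglyMeasurable (by fun_prop)
  · rw [norm_mul, norm_mul, norm_exp_neg_I_mul, one_mul, RCLike.norm_conj]
    exact hle _ _
  · have : Continuous fun z : WithLp 2 (V × V) => (starRingEnd ℂ) (h (z.fst - (1 / 2 : ℝ) • t)) :=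
      Complex.continuous_conj.comp (by fun_prop)
    fun_prop

theorem integrable_mul_conj (hω : IsWeightFunction ω K a b) {f h : V → ℂ} (hfc : Continuous f)
    (hf : RapidDecay ω f) (hhc : Continuous h) (hh : RapidDecay ω h) (x : V) :
    Integrable (fun t => f (x + (1 / 2 : ℝ) • t) * (starRingEnd ℂ) (h (x - (1 / 2 : ℝ) • t)))
      volume := by
  obtain ⟨φ, hφ, hle⟩ := exists_integrable_bound_mul hω hf hh
  refine hφ.mono' ?_ (Eventually.of_forall fun t => ?_)
  · have : Continuous fun t => (starRingEnd ℂ) (h (x - (1 / 2 : ℝ) • t)) :=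
      Complex.continuous_conj.comp (by fun_prop)
    exact Continuous.aestronglyMeasurable (by fun_prop)
  · rw [norm_mul, RCLike.norm_conj]
    exact hle _ _

theorem crossWigner_eq_fourierHat (f h : V → ℂ) (x ξ : V) :
    crossWigner f h (WithLp.toLp 2 (x, ξ)) =
      fourierHat (fun t => f (x + (1 / 2 : ℝ) • t) *
        (starRingEnd ℂ) (h (x - (1 / 2 : ℝ) • t))) ξ := by
  simp only [crossWigner, fourierHat, WithLp.toLp_fst, WithLp.toLp_snd, mul_assoc]

theorem RapidDecay.comp_toLp (hω : IsWeightFunction ω K a b) {F : WithLp 2 (V × V) → ℂ}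
    (hF : RapidDecay ω F) (x : V) : RapidDecay ω fun ξ => F (WithLp.toLp 2 (x, ξ)) := by
  refine hF.comp_of_le_add hω (A := fun ξ => WithLp.toLp 2 (x, ξ)) le_rfl fun ξ => ?_
  rw [zero_add, WithLp.prod_norm_eq_of_L2]
  refine Real.le_sqrt_of_sq_le ?_
  simp only [WithLp.toLp_snd]
  linarith [sq_nonneg ‖(WithLp.toLp 2 (x, ξ) : WithLp 2 (V × V)).fst‖]

/-- The Fourier transform of a cross-Wigner transform is a rescaled cross-Wigner transform. -/
theorem fourierHat_crossWigner (hω : IsWeightFunction ω K a b) {f h : V → ℂ}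
    (hf : FourierInvertible f) (hfd : RapidDecay ω f) (hfd' : RapidDecay ω (fourierHat f))
    (hh : FourierInvertible h) (hhd : RapidDecay ω h) (hhd' : RapidDecay ω (fourierHat h))
    (ζ : WithLp 2 (V × V)) :
    fourierHat (crossWigner f h) ζ =
      (fourierConst V * (2 ^ Module.finrank ℝ V)⁻¹ : ℝ) * crossWigner f (fun x => h (-x))
        (WithLp.toLp 2 ((-(1 / 2) : ℝ) • ζ.snd, (1 / 2 : ℝ) • ζ.fst)) := by
  have hWd := RapidDecay.crossWigner hω hf hfd hfd' hh hhd hhd'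
  have hWc := continuous_crossWigner hω hf.continuous hfd hh.continuous hhd
  have hW := hWd.integrable hω hWc
  -- For fixed `x`, `crossWigner f h (x, ·)` is a Fourier transform in `t`; integrating over `ξ`
  -- inverts it at `t = -ζ.snd`.
  have h1 : ∀ x : V, ∫ ξ : V, Complex.exp (-(Complex.I *
      (inner ℝ (WithLp.toLp 2 (x, ξ) : WithLp 2 (V × V)) ζ : ℝ))) *
        crossWigner f h (WithLp.toLp 2 (x, ξ)) =
      Complex.exp (-(Complex.I * (inner ℝ x ζ.fst : ℝ))) * ((fourierConst V : ℝ) *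
        (f (x + (-(1 / 2) : ℝ) • ζ.snd) * (starRingEnd ℂ) (h (x - (-(1 / 2) : ℝ) • ζ.snd)))) := by
    intro x
    have hc : Continuous fun t => f (x + (1 / 2 : ℝ) • t) *
        (starRingEnd ℂ) (h (x - (1 / 2 : ℝ) • t)) := by
      have h1 := hf.continuous
      have h2 := hh.continuous
      have : Continuous fun t => (starRingEnd ℂ) (h (x - (1 / 2 : ℝ) • t)) :=
        Complex.continuous_conj.comp (by fun_prop)
      fun_prop
    have hi := integrable_mul_conj hω hf.continuous hfd hh.continuous hhd x
    have hhat : Integrable (fourierHat fun t => f (x + (1 / 2 : ℝ) • t) *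
        (starRingEnd ℂ) (h (x - (1 / 2 : ℝ) • t))) volume := by
      have := (hWd.comp_toLp hω x).integrable hω (hWc.comp (by fun_prop))
      simpa only [crossWigner_eq_fourierHat] using this
    have h2 := fourierHat_fourierHat hc hi hhat ζ.snd
    have h3 : ∀ ξ : V, Complex.exp (-(Complex.I *
        (inner ℝ (WithLp.toLp 2 (x, ξ) : WithLp 2 (V × V)) ζ : ℝ))) *
          crossWigner f h (WithLp.toLp 2 (x, ξ)) =
        Complex.exp (-(Complex.I * (inner ℝ x ζ.fst : ℝ))) *
          (Complex.exp (-(Complex.I * (inner ℝ ξ ζ.snd : ℝ))) *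
            fourierHat (fun t => f (x + (1 / 2 : ℝ) • t) *
              (starRingEnd ℂ) (h (x - (1 / 2 : ℝ) • t))) ξ) := by
      intro ξ
      have h4 : inner ℝ (WithLp.toLp 2 (x, ξ) : WithLp 2 (V × V)) ζ =
          inner ℝ x ζ.fst + inner ℝ ξ ζ.snd := WithLp.prod_inner_apply _ _
      rw [crossWigner_eq_fourierHat, ← mul_assoc, ← Complex.exp_add, h4]
      congr 2
      push_cast
      ring
    simp only [h3]
    rw [integral_const_mul]
    congr 1
    refine h2.trans ?_
    rw [smul_neg, neg_smul, fourierConst]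
  have h4 : fourierHat (crossWigner f h) ζ = ∫ x : V,
      Complex.exp (-(Complex.I * (inner ℝ x ζ.fst : ℝ))) * ((fourierConst V : ℝ) *
        (f (x + (-(1 / 2) : ℝ) • ζ.snd) *
          (starRingEnd ℂ) (h (x - (-(1 / 2) : ℝ) • ζ.snd)))) := by
    rw [fourierHat, integral_withLp_prod (integrable_fourier_kernel_mul hW ζ)]
    exact integral_congr_ae (Eventually.of_forall h1)
  -- Replacing `x` by `t/2` gives the remaining integral the form of a cross-Wigner transform, with
  -- `h` reflected.
  have h5 := Measure.integral_comp_smul (volume : Measure V) (fun x =>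
    Complex.exp (-(Complex.I * (inner ℝ x ζ.fst : ℝ))) * ((fourierConst V : ℝ) *
        (f (x + (-(1 / 2) : ℝ) • ζ.snd) *
          (starRingEnd ℂ) (h (x - (-(1 / 2) : ℝ) • ζ.snd))))) (1 / 2)
  rw [abs_half_pow_inv, ← h4] at h5
  have h6 : fourierHat (crossWigner f h) ζ = ((2 ^ Module.finrank ℝ V)⁻¹ : ℝ) •
      ((2 ^ Module.finrank ℝ V : ℝ) • fourierHat (crossWigner f h) ζ) := by
    rw [smul_smul, inv_mul_cancel₀ (by positivity), one_smul]
  rw [h6, ← h5, mul_comm (fourierConst V), Complex.ofReal_mul, mul_assoc, ← Complex.real_smul,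
    crossWigner, ← integral_const_mul]
  congr 1
  refine integral_congr_ae (Eventually.of_forall fun t => ?_)
  simp only [WithLp.toLp_fst, WithLp.toLp_snd, inner_smul_left, inner_smul_right, neg_sub,
    RCLike.conj_to_real, add_comm ((-(1 / 2) : ℝ) • ζ.snd)]
  ring

theorem crossWigner_mem_ultraSchwartz (hω : IsWeightFunction ω K a b) {f h : V → ℂ}
    (hf : f ∈ ultraSchwartz V ω) (hh : h ∈ ultraSchwartz V ω) :
    crossWigner f h ∈ ultraSchwartz (WithLp 2 (V × V)) ω := by
  have hf1 := fourierInvertible_of_mem_ultraSchwartz hω hf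
  have hh1 := fourierInvertible_of_mem_ultraSchwartz hω hh
  have hf2 := rapidDecay_of_mem_ultraSchwartz hω hf
  have hh2 := rapidDecay_of_mem_ultraSchwartz hω hh
  have hf3 := rapidDecay_fourierHat_of_mem_ultraSchwartz hω hf
  have hh3 := rapidDecay_fourierHat_of_mem_ultraSchwartz hω hh
  refine mem_ultraSchwartz_of_rapidDecay hω
    (continuous_crossWigner hω hf1.continuous hf2 hh1.continuous hh2)
    (RapidDecay.crossWigner hω hf1 hf2 hf3 hh1 hh2 hh3) ?_
  have hneg : ∀ F : V → ℂ, RapidDecay ω F → RapidDecay ω fun x => F (-x) := fun F hF =>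
    hF.comp_of_le_add hω (A := fun x => -x) le_rfl fun x => by rw [zero_add, norm_neg]
  have h4 := RapidDecay.crossWigner hω hf1 hf2 hf3 hh1.comp_neg (hneg h hh2) (by
    rw [funext (fourierHat_comp_neg h)]
    exact hneg _ hh3)
  -- The map halves the norm exactly, the limiting case allowed by the doubling lemma.
  have h5 := h4.comp_of_le_two_mul hω (A := fun ζ : WithLp 2 (V × V) =>
    WithLp.toLp 2 ((-(1 / 2) : ℝ) • ζ.snd, (1 / 2 : ℝ) • ζ.fst)) (fun ζ => by
      refine le_of_eq ?_
      rw [← sq_eq_sq₀ (norm_nonneg _) (by positivity), mul_pow, WithLp.prod_norm_sq_eq_of_L2,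
        WithLp.prod_norm_sq_eq_of_L2]
      simp only [WithLp.toLp_fst, WithLp.toLp_snd, norm_smul, mul_pow, Real.norm_eq_abs, sq_abs]
      ring)
  refine h5.mono (norm_nonneg ((fourierConst V * (2 ^ Module.finrank ℝ V)⁻¹ : ℝ) : ℂ)) fun ζ => ?_
  rw [fourierHat_crossWigner hω hf1 hf2 hf3 hh1 hh2 hh3, norm_mul]
  rfl

end WignerMembership

/-! ### Recovering `f` and its Fourier transform from the short-time Fourier transform. -/

section ShortTimeFourier

variable {V : Type*} [NormedAddCommGroup V] [InnerProductSpace ℝ V] [FiniteDimensional ℝ V]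
  [MeasurableSpace V] [BorelSpace V] {ω : ℝ → ℝ} {K a b : ℝ}

/-- The short-time Fourier transform on a Euclidean space. -/
noncomputable def shortTimeFourier (g f : V → ℂ) (z : WithLp 2 (V × V)) : ℂ :=
  ∫ y, f y * (starRingEnd ℂ) (g (y - z.fst)) *
    Complex.exp (-(Complex.I * (inner ℝ y z.snd : ℝ)))

theorem shortTimeFourier_eq_fourierHat (g f : V → ℂ) (x ξ : V) :
    shortTimeFourier g f (WithLp.toLp 2 (x, ξ)) =
      fourierHat (fun y => f y * (starRingEnd ℂ) (g (y - x))) ξ := by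
  simp only [shortTimeFourier, fourierHat, WithLp.toLp_fst, WithLp.toLp_snd]
  refine integral_congr_ae (Eventually.of_forall fun y => ?_)
  ring

theorem continuous_shortTimeFourier {g f : V → ℂ} (hg : FourierInvertible g)
    (hf : FourierInvertible f) : Continuous (shortTimeFourier g f) := by
  obtain ⟨C, hC⟩ := hg.exists_norm_le
  have hfc := hf.continuous
  have hgc := hg.continuous
  refine continuous_of_dominated (bound := fun y => ‖f y‖ * C) (fun z => ?_)
    (fun z => Eventually.of_forall fun y => ?_) (hf.integrable.norm.mul_const C)
    (Eventually.of_forall fun y => ?_)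
  · have : Continuous fun y => (starRingEnd ℂ) (g (y - z.fst)) :=
      Complex.continuous_conj.comp (by fun_prop)
    exact Continuous.aestronglyMeasurable (by fun_prop)
  · rw [norm_mul, norm_mul, norm_exp_neg_I_mul, mul_one, RCLike.norm_conj]
    gcongr
    exact hC _
  · have : Continuous fun z : WithLp 2 (V × V) => (starRingEnd ℂ) (g (y - z.fst)) :=
      Complex.continuous_conj.comp (by fun_prop)
    fun_prop

/-- `V_g f(x, ·)` is the transform of `f · conj g(· - x)`; inversion at `y` bounds `|f(y)| |g(y -
x)|`. Multiply by `|g(y - x)|` and integrate over `x`. -/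
theorem enorm_mul_lintegral_le_shortTimeFourier {g f : V → ℂ} (hg : FourierInvertible g)
    (hf : FourierInvertible f) (y : V) :
    ENNReal.ofReal (fourierConst V) * (‖f y‖ₑ * ∫⁻ x, ‖g x‖ₑ ^ 2) ≤
      ∫⁻ z, ‖shortTimeFourier g f z‖ₑ * ‖g (y - z.fst)‖ₑ := by
  have hfc := hf.continuous
  have hgc := hg.continuous
  have hV := continuous_shortTimeFourier hg hf
  have m1 : Measurable fun z : WithLp 2 (V × V) =>
      ‖shortTimeFourier g f z‖ₑ * ‖g (y - z.fst)‖ₑ := by fun_prop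
  rw [lintegral_withLp_prod m1, ← lintegral_sub_left_eq_self (fun x => ‖g x‖ₑ ^ 2) y,
    ← lintegral_const_mul' _ _ enorm_ne_top, ← lintegral_const_mul' _ _ ENNReal.ofReal_ne_top]
  refine lintegral_mono fun x => ?_
  simp only [WithLp.toLp_fst]
  rw [lintegral_mul_const' _ _ enorm_ne_top]
  have hgx : Integrable (fun y => (starRingEnd ℂ) (g (y - x))) volume :=
    hg.conj.integrable.comp_sub_right x
  have hc : Continuous fun y => f y * (starRingEnd ℂ) (g (y - x)) := by
    have : Continuous fun y => (starRingEnd ℂ) (g (y - x)) :=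
      Complex.continuous_conj.comp (by fun_prop)
    fun_prop
  have h1 := enorm_le_lintegral_fourierHat hc (hf.integrable_mul hgx) y
  simp only [← shortTimeFourier_eq_fourierHat, enorm_mul, enorm_conj] at h1
  calc _ = ENNReal.ofReal (fourierConst V) * (‖f y‖ₑ * ‖g (y - x)‖ₑ) * ‖g (y - x)‖ₑ := by ring
    _ ≤ _ := by gcongr

/-- Parseval for `f` against the window `e^{iy·ξ} g(y - x)`: up to a phase, passing to Fourier
transforms rotates phase space. -/
theorem enorm_shortTimeFourier_fourierHat {g f : V → ℂ} (hg : FourierInvertible g)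
    (hf : FourierInvertible f) (x ξ : V) :
    ‖shortTimeFourier (fourierHat g) (fourierHat f) (WithLp.toLp 2 (ξ, -x))‖ₑ =
      ENNReal.ofReal (fourierConst V) * ‖shortTimeFourier g f (WithLp.toLp 2 (x, ξ))‖ₑ := by
  have h1 := integral_fourierHat_mul_conj hf ((hg.translate (-x)).modulate (-ξ)).integrable
  have h2 : ∫ y, f y * (starRingEnd ℂ)
      (Complex.exp (-(Complex.I * (inner ℝ y (-ξ) : ℝ))) * g (-x + y)) =
        shortTimeFourier g f (WithLp.toLp 2 (x, ξ)) := by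
    refine integral_congr_ae (Eventually.of_forall fun y => ?_)
    simp only [WithLp.toLp_fst, WithLp.toLp_snd, map_mul, ← Complex.exp_conj, map_neg,
      Complex.conj_I, Complex.conj_ofReal, inner_neg_right, neg_add_eq_sub]
    have : Complex.exp (-(-Complex.I * ((-inner ℝ y ξ : ℝ) : ℂ))) =
        Complex.exp (-(Complex.I * ((inner ℝ y ξ : ℝ) : ℂ))) := by
      push_cast
      ring_nf
    rw [this]
    ring
  rw [h2] at h1
  rw [← enorm_fourierConst, ← enorm_mul, ← h1]
  have h3 : ∫ η, fourierHat f η * (starRingEnd ℂ) (fourierHat (fun y =>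
      Complex.exp (-(Complex.I * (inner ℝ y (-ξ) : ℝ))) * g (-x + y)) η) =
      Complex.exp (-(Complex.I * (inner ℝ x ξ : ℝ))) *
        shortTimeFourier (fourierHat g) (fourierHat f) (WithLp.toLp 2 (ξ, -x)) := by
    rw [shortTimeFourier, ← integral_const_mul]
    refine integral_congr_ae (Eventually.of_forall fun η => ?_)
    simp only
    rw [fourierHat_modulate (fun y => g (-x + y)), fourierHat_translate]
    simp only [WithLp.toLp_fst, WithLp.toLp_snd, map_mul, ← Complex.exp_conj, Complex.conj_I, Complex.conj_ofReal,
      ← sub_eq_add_neg, inner_neg_right, inner_neg_left, inner_sub_right,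
      real_inner_comm x]
    have : Complex.exp (-Complex.I * ((-inner ℝ x η - -inner ℝ x ξ : ℝ) : ℂ)) =
        Complex.exp (-(Complex.I * (inner ℝ x ξ : ℝ))) *
          Complex.exp (-(Complex.I * ((-inner ℝ x η : ℝ) : ℂ))) := by
      rw [← Complex.exp_add]
      push_cast
      ring_nf
    rw [this]
    ring
  rw [h3, enorm_mul, enorm_exp_neg_I_mul, one_mul]

/-- Plancherel's theorem. -/
theorem lintegral_enorm_fourierHat_sq {g : V → ℂ} (hg : FourierInvertible g) :
    ∫⁻ ξ, ‖fourierHat g ξ‖ₑ ^ 2 = ENNReal.ofReal (fourierConst V) * ∫⁻ x, ‖g x‖ₑ ^ 2 := by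
  have key : ∀ u : V → ℂ, FourierInvertible u →
      ‖∫ x, u x * (starRingEnd ℂ) (u x)‖ₑ = ∫⁻ x, ‖u x‖ₑ ^ 2 := by
    intro u hu
    have h1 : ∀ x, u x * (starRingEnd ℂ) (u x) = ((‖u x‖ ^ 2 : ℝ) : ℂ) := fun x => by
      rw [Complex.mul_conj, Complex.normSq_eq_norm_sq]
    have h2 : Integrable (fun x => ‖u x‖ ^ 2) volume := by
      have := (hu.integrable_mul hu.conj.integrable).norm
      simpa only [norm_mul, RCLike.norm_conj, ← pow_two] using this
    simp only [h1]
    rw [integral_complex_ofReal, ← ofReal_norm, Complex.norm_real,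
      Real.norm_of_nonneg (integral_nonneg fun x => by positivity),
      ofReal_integral_eq_lintegral_ofReal h2 (Eventually.of_forall fun x => by positivity)]
    refine lintegral_congr fun x => ?_
    rw [ENNReal.ofReal_pow (norm_nonneg _), ofReal_norm]
  rw [← key _ hg.hat, ← key _ hg, integral_fourierHat_mul_conj hg hg.integrable, enorm_mul,
    enorm_fourierConst]

/-- The inversion bound for `f̂` with window `ĝ`, rotated back to `V_g f`. Plancherel for `ĝ` and
the rotation each contribute `(2π)^d`; one of these factors is cancelled. -/
theorem enorm_fourierHat_mul_lintegral_le_shortTimeFourier {g f : V → ℂ}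
    (hg : FourierInvertible g) (hf : FourierInvertible f) (η : V) :
    ENNReal.ofReal (fourierConst V) * (‖fourierHat f η‖ₑ * ∫⁻ x, ‖g x‖ₑ ^ 2) ≤
      ∫⁻ z, ‖shortTimeFourier g f z‖ₑ * ‖fourierHat g (η - z.snd)‖ₑ := by
  have hgc := hg.continuous_hat
  have hV := continuous_shortTimeFourier hg hf
  have hV' := continuous_shortTimeFourier hg.hat hf.hat
  have h1 := enorm_mul_lintegral_le_shortTimeFourier hg.hat hf.hat η
  have hc0 : ENNReal.ofReal (fourierConst V) ≠ 0 := by simpa using fourierConst_pos V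
  have h2 : ∫⁻ z, ‖shortTimeFourier (fourierHat g) (fourierHat f) z‖ₑ *
      ‖fourierHat g (η - z.fst)‖ₑ = ENNReal.ofReal (fourierConst V) *
        ∫⁻ z, ‖shortTimeFourier g f z‖ₑ * ‖fourierHat g (η - z.snd)‖ₑ := by
    rw [lintegral_withLp_prod (by fun_prop), lintegral_withLp_prod (by fun_prop),
      lintegral_lintegral_swap (f := fun x ξ => ‖shortTimeFourier g f (WithLp.toLp 2 (x, ξ))‖ₑ *
        ‖fourierHat g (η - (WithLp.toLp 2 (x, ξ)).snd)‖ₑ) (by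
          refine Measurable.aemeasurable ?_
          simp only [Function.uncurry_def]
          fun_prop),
      ← lintegral_const_mul' _ _ ENNReal.ofReal_ne_top]
    refine lintegral_congr fun ξ => ?_
    rw [← lintegral_const_mul' _ _ ENNReal.ofReal_ne_top, ← lintegral_neg_eq_self]
    refine lintegral_congr fun x => ?_
    rw [enorm_shortTimeFourier_fourierHat hg hf, mul_assoc, WithLp.toLp_fst, WithLp.toLp_snd]
  rw [h2, lintegral_enorm_fourierHat_sq hg] at h1
  refine (ENNReal.mul_le_mul_iff_right hc0 ENNReal.ofReal_ne_top).1 (le_trans (le_of_eq ?_) h1)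
  ring

/-- The set where the bound fails is open and null, hence empty; this makes the essential supremum
usable at every point. -/
theorem enorm_le_weightedNorm_top_of_continuous (hω : IsWeightFunction ω K a b) (l : ℝ)
    {F : V → ℂ} (hF : Continuous F) (x : V) :
    expWeight ω l x * ‖F x‖ₑ ≤ weightedNorm ω ∞ l F := by
  have h1 : Continuous fun x => ‖Real.exp (l * ω ‖x‖) • F x‖ₑ :=
    ((hω.continuous_exp l).smul hF).enorm
  simp only [enorm_exp_smul] at h1
  by_contra! hlt
  have hopen : IsOpen {x | weightedNorm ω ∞ l F < expWeight ω l x * ‖F x‖ₑ} :=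
    isOpen_lt continuous_const h1
  have hnull := ae_le_weightedNorm_top (ω := ω) l F
  rw [ae_iff] at hnull
  simp only [not_le] at hnull
  exact (hopen.measure_pos volume ⟨x, hlt⟩).ne' hnull

/-- Weighted bound of a partial convolution of `Φ` and `γ` along a norm-decreasing map `A`, such as
one of the two coordinate projections of phase space. -/
theorem weighted_mul_lintegral_le (hω : IsWeightFunction ω K a b) {l : ℝ} (hl : 0 ≤ l)
    {Φ : WithLp 2 (V × V) → ℂ} (hΦ : Continuous Φ) {A : WithLp 2 (V × V) → V}
    (hAle : ∀ z, ‖A z‖ ≤ ‖z‖) {γ : V → ℂ} (hγ : Continuous γ) (y : V) :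
    expWeight ω l y * ∫⁻ z, ‖Φ z‖ₑ * ‖γ (y - A z)‖ₑ ≤
      ENNReal.ofReal (Real.exp (K * l)) * weightedNorm ω ∞ (K * l) γ *
        ∫⁻ z, expWeight ω (K * l) z * ‖Φ z‖ₑ := by
  have hKl : 0 ≤ K * l := mul_nonneg hω.K_pos.le hl
  have hm : Measurable fun z => expWeight ω (K * l) z * ‖Φ z‖ₑ := by
    have := hω.continuous_expWeight (V := WithLp 2 (V × V)) (K * l)
    fun_prop
  rw [← lintegral_const_mul' _ _ (expWeight_ne_top _ _), ← lintegral_const_mul _ hm]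
  refine lintegral_mono fun z => ?_
  have h1 : expWeight ω l y ≤ ENNReal.ofReal (Real.exp (K * l)) *
      (expWeight ω (K * l) (y - A z) * expWeight ω (K * l) z) := by
    refine hω.expWeight_le_mul hl ?_
    calc ‖y‖ = ‖(y - A z) + A z‖ := by rw [sub_add_cancel]
      _ ≤ ‖y - A z‖ + ‖A z‖ := norm_add_le _ _
      _ ≤ _ := by gcongr; exact hAle z
  calc expWeight ω l y * (‖Φ z‖ₑ * ‖γ (y - A z)‖ₑ)
      ≤ (ENNReal.ofReal (Real.exp (K * l)) *
        (expWeight ω (K * l) (y - A z) * expWeight ω (K * l) z)) *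
        (‖Φ z‖ₑ * ‖γ (y - A z)‖ₑ) := by gcongr
    _ = ENNReal.ofReal (Real.exp (K * l)) * (expWeight ω (K * l) (y - A z) * ‖γ (y - A z)‖ₑ) *
        (expWeight ω (K * l) z * ‖Φ z‖ₑ) := by ring
    _ ≤ _ := by
      gcongr
      exact enorm_le_weightedNorm_top_of_continuous hω _ hγ _

theorem norm_fst_le_withLp (z : WithLp 2 (V × V)) : ‖z.fst‖ ≤ ‖z‖ := by
  rw [WithLp.prod_norm_eq_of_L2]
  exact Real.le_sqrt_of_sq_le (by linarith [sq_nonneg ‖z.snd‖])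

theorem norm_snd_le_withLp (z : WithLp 2 (V × V)) : ‖z.snd‖ ≤ ‖z‖ := by
  rw [WithLp.prod_norm_eq_of_L2]
  exact Real.le_sqrt_of_sq_le (by linarith [sq_nonneg ‖z.fst‖])

/-- Splitting `w` into coordinates costs `e^{Kl}` and turns `l` into `Kl`. Each coordinate is then
bounded by a partial convolution, costing `e^{K²l}` and turning `Kl` into `K²l`; in total
`e^{K(1+2K)l}`. -/
theorem weightedNorm_top_rihaczekForm_le (hω : IsWeightFunction ω K a b) {l : ℝ} (hl : 0 ≤ l)
    {g f : V → ℂ} (hg : FourierInvertible g) (hf : FourierInvertible f) :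
    (ENNReal.ofReal (fourierConst V) * ∫⁻ x, ‖g x‖ₑ ^ 2) ^ 2 *
        weightedNorm ω ∞ l (rihaczekForm f) ≤
      ENNReal.ofReal (Real.exp (K * (1 + 2 * K) * l)) * weightedNorm ω ∞ (K ^ 2 * l) g *
        weightedNorm ω ∞ (K ^ 2 * l) (fourierHat g) *
        weightedNorm ω 1 (K ^ 2 * l) (shortTimeFourier g f) ^ 2 := by
  have hKl : 0 ≤ K * l := mul_nonneg hω.K_pos.le hl
  have hV := continuous_shortTimeFourier hg hf
  set G := ENNReal.ofReal (fourierConst V) * ∫⁻ x, ‖g x‖ₑ ^ 2 with hG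
  have hpt : ∀ w : WithLp 2 (V × V), G ^ 2 * (expWeight ω l w * ‖rihaczekForm f w‖ₑ) ≤
      ENNReal.ofReal (Real.exp (K * (1 + 2 * K) * l)) * weightedNorm ω ∞ (K ^ 2 * l) g *
        weightedNorm ω ∞ (K ^ 2 * l) (fourierHat g) *
        weightedNorm ω 1 (K ^ 2 * l) (shortTimeFourier g f) ^ 2 := by
    intro w
    have h1 := weighted_mul_lintegral_le hω hKl hV (A := fun z => z.fst)
      norm_fst_le_withLp hg.continuous w.fst
    have h2 := weighted_mul_lintegral_le hω hKl hV (A := fun z => z.snd)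
      norm_snd_le_withLp hg.continuous_hat w.snd
    have h3 := enorm_mul_lintegral_le_shortTimeFourier hg hf w.fst
    have h4 := enorm_fourierHat_mul_lintegral_le_shortTimeFourier hg hf w.snd
    have h5 := hω.expWeight_le_mul hl (norm_le_add_withLp w)
    have hKK : K * (K * l) = K ^ 2 * l := by ring
    rw [hKK, ← weightedNorm_one] at h1 h2
    have hexp : ENNReal.ofReal (Real.exp (K * (1 + 2 * K) * l)) =
        ENNReal.ofReal (Real.exp (K * l)) * (ENNReal.ofReal (Real.exp (K ^ 2 * l)) *
          ENNReal.ofReal (Real.exp (K ^ 2 * l))) := by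
      rw [← ENNReal.ofReal_mul (Real.exp_pos _).le, ← ENNReal.ofReal_mul (Real.exp_pos _).le,
        ← Real.exp_add, ← Real.exp_add]
      ring_nf
    rw [enorm_rihaczekForm]
    calc G ^ 2 * (expWeight ω l w * (‖f w.fst‖ₑ * ‖fourierHat f w.snd‖ₑ))
        ≤ G ^ 2 * ((ENNReal.ofReal (Real.exp (K * l)) *
            (expWeight ω (K * l) w.fst * expWeight ω (K * l) w.snd)) *
            (‖f w.fst‖ₑ * ‖fourierHat f w.snd‖ₑ)) := by gcongr
      _ = ENNReal.ofReal (Real.exp (K * l)) * ((expWeight ω (K * l) w.fst *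
          (ENNReal.ofReal (fourierConst V) * (‖f w.fst‖ₑ * ∫⁻ x, ‖g x‖ₑ ^ 2))) *
          (expWeight ω (K * l) w.snd *
          (ENNReal.ofReal (fourierConst V) * (‖fourierHat f w.snd‖ₑ * ∫⁻ x, ‖g x‖ₑ ^ 2)))) := by
          rw [hG]; ring
      _ ≤ ENNReal.ofReal (Real.exp (K * l)) *
          ((ENNReal.ofReal (Real.exp (K ^ 2 * l)) * weightedNorm ω ∞ (K ^ 2 * l) g *
            weightedNorm ω 1 (K ^ 2 * l) (shortTimeFourier g f)) *
          (ENNReal.ofReal (Real.exp (K ^ 2 * l)) * weightedNorm ω ∞ (K ^ 2 * l) (fourierHat g) *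
            weightedNorm ω 1 (K ^ 2 * l) (shortTimeFourier g f))) := by
          exact mul_le_mul_right (mul_le_mul' ((mul_le_mul_right h3 _).trans h1)
            ((mul_le_mul_right h4 _).trans h2)) _
      _ = _ := by rw [hexp]; ring
  rw [weightedNorm_top, ← ENNReal.essSup_const_mul]
  exact essSup_le_of_ae_le _ (Eventually.of_forall hpt)

theorem weightedNorm_two_mul_sq (p : ℝ≥0∞) (l : ℝ) (Φ : WithLp 2 (V × V) → ℂ) :
    weightedNorm ω (2 * p) l Φ ^ 2 = weightedNorm ω p (2 * l) fun z => ‖Φ z‖ ^ 2 := by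
  have h := eLpNorm_norm_rpow (p := p) (q := 2) (μ := volume)
    (fun z : WithLp 2 (V × V) => Real.exp (l * ω ‖z‖) • Φ z) two_pos
  rw [ENNReal.ofReal_ofNat, mul_comm p] at h
  rw [weightedNorm, weightedNorm, ← ENNReal.rpow_natCast]
  refine h.symm.trans (congrArg (fun F => eLpNorm F p volume) (funext fun z => ?_))
  rw [norm_smul, Real.norm_of_nonneg (Real.exp_pos _).le, Real.rpow_ofNat, mul_pow, smul_eq_mul,
    ← Real.exp_nat_mul]
  push_cast
  ring_nf

end ShortTimeFourier

/-! ### Estimates of `Q_σ f` by the Wigner transform and the Rihaczek form. -/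

section Cohen

variable {N : ℕ} {ω : ℝ → ℝ} {K a b : ℝ}

theorem wigner_mem_ultraSchwartz (hω : IsWeightFunction ω K a b) {f : Space N → ℂ}
    (hf : f ∈ ultraSchwartz (Space N) ω) : wigner f ∈ ultraSchwartz (PhaseSpace N) ω :=
  crossWigner_mem_ultraSchwartz hω hf hf

/-- Here membership of `Wig(f)(z - ·)` in `𝒮_ω` is essential: it turns the abstract pairing into an
integral against `s`. -/
theorem enorm_cohen_le (hω : IsWeightFunction ω K a b)
    {σ : UltraDistribution (PhaseSpace N) ω} {s : PhaseSpace N → ℂ} (hs : σ.IsFunction s)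
    {f : Space N → ℂ} (hf : f ∈ ultraSchwartz (Space N) ω) (z : PhaseSpace N) :
    ‖cohen σ f z‖ₑ ≤ ∫⁻ w, ‖s w‖ₑ * ‖wigner f (z - w)‖ₑ := by
  have hmem := comp_sub_mem_ultraSchwartz hω (wigner_mem_ultraSchwartz hω hf) z
  rw [cohen, UltraDistribution.conv, UltraDistribution.pair, dif_pos hmem, (hs.2 ⟨_, hmem⟩).2]
  refine (enorm_integral_le_lintegral_enorm _).trans (le_of_eq (lintegral_congr fun w => ?_))
  rw [enorm_mul]

theorem weightedNorm_cohen_le (hω : IsWeightFunction ω K a b) (p p' : ℝ≥0∞)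
    [p'.HolderConjugate p]
    {σ : UltraDistribution (PhaseSpace N) ω} {s : PhaseSpace N → ℂ} (hs : σ.IsFunction s)
    {f : Space N → ℂ} (hf : f ∈ ultraSchwartz (Space N) ω) {l : ℝ} (hl : 0 ≤ l) :
    weightedNorm ω ∞ l (cohen σ f) ≤
      constWigner ω K p' s l * weightedNorm ω p (K * l) (wigner f) := by
  have hW := (wigner_mem_ultraSchwartz hω hf).2.1.continuous
  refine weightedNorm_top_le fun z => ?_
  have h1 := hω.lintegral_weighted_mul_comp_sub_le p' p (K * l) (K * l) hs.1
    hW.aestronglyMeasurable z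
  rw [constWigner, mul_assoc]
  refine le_trans ?_ (mul_le_mul_right h1 _)
  rw [← lintegral_const_mul' _ _ ENNReal.ofReal_ne_top]
  refine (mul_le_mul_right (enorm_cohen_le hω hs hf z) _).trans ?_
  rw [← lintegral_const_mul' _ _ (expWeight_ne_top _ _)]
  refine lintegral_mono fun w => ?_
  have h2 : expWeight ω l z ≤ ENNReal.ofReal (Real.exp (K * l)) *
      (expWeight ω (K * l) w * expWeight ω (K * l) (z - w)) := by
    refine hω.expWeight_le_mul hl ?_
    calc ‖z‖ = ‖w + (z - w)‖ := by rw [add_sub_cancel]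
      _ ≤ _ := norm_add_le _ _
  calc expWeight ω l z * (‖s w‖ₑ * ‖wigner f (z - w)‖ₑ)
      ≤ (ENNReal.ofReal (Real.exp (K * l)) *
        (expWeight ω (K * l) w * expWeight ω (K * l) (z - w))) *
        (‖s w‖ₑ * ‖wigner f (z - w)‖ₑ) := by gcongr
    _ = _ := by ring

theorem weightedNorm_wigner_sq_le (hω : IsWeightFunction ω K a b) (p p' : ℝ≥0∞)
    [p.HolderConjugate p'] {f : Space N → ℂ} (hf : f ∈ ultraSchwartz (Space N) ω) {l : ℝ}
    (hl : 0 ≤ l) :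
    weightedNorm ω ∞ l (wigner f) ^ 2 ≤ ENNReal.ofReal ((4 / (2 * Real.pi)) ^ N) *
      (weightedNorm ω p (2 * l) (rihaczek f) * weightedNorm ω p' (2 * l) (rihaczek f)) := by
  have hf' := fourierInvertible_of_mem_ultraSchwartz hω hf
  have := fun z => hω.weighted_crossWigner_sq_le p p' hf' hf' hl z
  rw [finrank_euclideanSpace_fin] at this
  exact weightedNorm_top_sq_le this

theorem weightedNorm_cohen_sq_le (hω : IsWeightFunction ω K a b) (p p' : ℝ≥0∞)
    [p.HolderConjugate p']
    {σ : UltraDistribution (PhaseSpace N) ω} {s : PhaseSpace N → ℂ} (hs : σ.IsFunction s)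
    {f : Space N → ℂ} (hf : f ∈ ultraSchwartz (Space N) ω) {l : ℝ} (hl : 0 ≤ l) :
    weightedNorm ω ∞ l (cohen σ f) ^ 2 ≤
      constRihaczek ω K s l * (weightedNorm ω p (4 * K ^ 3 * l) (rihaczek f) *
        weightedNorm ω p' (4 * K ^ 3 * l) (rihaczek f)) := by
  have hK := hω.one_le_K
  have hKl : 0 ≤ K * l := mul_nonneg hω.K_pos.le hl
  -- The argument needs only the weight `2Kl` and, below, the factor `e^{2Kl}`; since `K ≥ 1`, the
  -- larger stated exponents follow by monotonicity.
  have hle : 2 * (K * l) ≤ 4 * K ^ 3 * l := by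
    have h1 : K * 1 ≤ K * K ^ 2 := by gcongr; exact one_le_pow₀ hK
    nlinarith
  have h1 := weightedNorm_cohen_le hω ∞ 1 hs hf hl
  have h2 := weightedNorm_wigner_sq_le hω p p' hf hKl
  calc weightedNorm ω ∞ l (cohen σ f) ^ 2
      ≤ (constWigner ω K 1 s l * weightedNorm ω ∞ (K * l) (wigner f)) ^ 2 := by gcongr
    _ = ENNReal.ofReal (Real.exp (K * l)) ^ 2 * weightedNorm ω 1 (K * l) s ^ 2 *
        weightedNorm ω ∞ (K * l) (wigner f) ^ 2 := by rw [constWigner]; ring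
    _ ≤ ENNReal.ofReal (Real.exp (K * (2 + K + 2 * K ^ 2) * l)) * weightedNorm ω 1 (K * l) s ^ 2 *
        (ENNReal.ofReal ((4 / (2 * Real.pi)) ^ N) *
          (weightedNorm ω p (4 * K ^ 3 * l) (rihaczek f) *
            weightedNorm ω p' (4 * K ^ 3 * l) (rihaczek f))) := by
        gcongr
        · rw [← ENNReal.ofReal_pow (Real.exp_pos _).le, ← Real.exp_nat_mul]
          refine ENNReal.ofReal_le_ofReal (Real.exp_le_exp.2 ?_)
          push_cast
          nlinarith [mul_nonneg hKl hω.K_pos.le, mul_nonneg hKl (sq_nonneg K)]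
        · refine h2.trans ?_
          gcongr
          · exact hω.weightedNorm_mono _ hle _
          · exact hω.weightedNorm_mono _ hle _
    _ = _ := by
        rw [constRihaczek, ENNReal.ofReal_mul (by positivity)]
        ring

end Cohen

/-! ### Estimate of `Q_σ f` by the spectrogram. -/

section Spectrogram

variable {N : ℕ} {ω : ℝ → ℝ} {K a b : ℝ}

theorem eLpNorm_two_sq {α : Type*} [MeasurableSpace α] {μ : Measure α} (g : α → ℂ) :
    eLpNorm g 2 μ ^ 2 = ∫⁻ x, ‖g x‖ₑ ^ 2 ∂μ := by
  rw [eLpNorm_eq_lintegral_rpow_enorm_toReal two_ne_zero ENNReal.ofNat_ne_top,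
    ← ENNReal.rpow_natCast, ← ENNReal.rpow_mul]
  simp

/-- At `τ = 1/2` one has `τ - τ² = 1/4`, and both sides agree for `E = 1`; the factor `(2π)^{2N}`
comes from the two inversions in `weightedNorm_top_rihaczekForm_le`. -/
theorem four_div_two_pi_rpow_le {E : ℝ} (hE : 1 ≤ E) :
    (4 / (2 * Real.pi)) ^ ((N : ℝ) / 2) ≤
      E / ((2 * Real.pi) ^ (5 / 2 * (N : ℝ)) * (1 / 2 - (1 / 2) ^ 2) ^ ((N : ℝ) / 2)) *
        ((2 * Real.pi) ^ N) ^ 2 := by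
  have hpi : 0 < 2 * Real.pi := by positivity
  have h1 : ((1 : ℝ) / 2 - (1 / 2) ^ 2) = 4⁻¹ := by norm_num
  have h2 : (2 * Real.pi) ^ (5 / 2 * (N : ℝ)) =
      ((2 * Real.pi) ^ N) ^ 2 * (2 * Real.pi) ^ ((N : ℝ) / 2) := by
    rw [← pow_mul, ← Real.rpow_natCast, ← Real.rpow_add hpi]
    congr 1
    push_cast
    ring
  rw [h1, h2, Real.inv_rpow (by norm_num), Real.div_rpow (by norm_num) hpi.le]
  have h4 : (0 : ℝ) < 4 ^ ((N : ℝ) / 2) := by positivity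
  have h5 : 0 < (2 * Real.pi) ^ ((N : ℝ) / 2) := by positivity
  have h6 : 0 < (2 * Real.pi) ^ N := by positivity
  rw [div_mul_eq_mul_div, le_div_iff₀ (by positivity), div_mul_eq_mul_div, div_le_iff₀ h5]
  have h7 : (4 : ℝ) ^ ((N : ℝ) / 2) * (((2 * Real.pi) ^ N) ^ 2 * (2 * Real.pi) ^ ((N : ℝ) / 2) *
      (4 ^ ((N : ℝ) / 2))⁻¹) =
      1 * ((2 * Real.pi) ^ N) ^ 2 * (2 * Real.pi) ^ ((N : ℝ) / 2) := by
    field_simp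
  rw [h7]
  gcongr

theorem weightedNorm_wigner_le_rihaczek (hω : IsWeightFunction ω K a b) {f : Space N → ℂ}
    (hf : f ∈ ultraSchwartz (Space N) ω) {l : ℝ} (hl : 0 ≤ l) :
    weightedNorm ω ∞ l (wigner f) ≤ ENNReal.ofReal ((4 / (2 * Real.pi)) ^ ((N : ℝ) / 2)) *
      weightedNorm ω 2 (2 * l) (rihaczek f) := by
  have h := weightedNorm_wigner_sq_le hω 2 2 hf hl
  have h2 : ENNReal.ofReal ((4 / (2 * Real.pi)) ^ N) =
      ENNReal.ofReal ((4 / (2 * Real.pi)) ^ ((N : ℝ) / 2)) ^ 2 := by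
    rw [← ENNReal.ofReal_pow (by positivity), ← Real.rpow_natCast, ← Real.rpow_natCast,
      ← Real.rpow_mul (by positivity)]
    congr 2
    push_cast
    ring
  rw [h2, ← pow_two, ← mul_pow] at h
  exact (ENNReal.pow_le_pow_left_iff two_ne_zero).1 h

/-- The expression whose infimum enters the estimate of the Wigner transform by the spectrogram. -/
noncomputable def spectrogramTerm (ω : ℝ → ℝ) (K : ℝ) (p : ℝ≥0∞) (g : Space N → ℂ) (l μ₁ μ₂ : ℝ) :
    ℝ≥0∞ :=
  ENNReal.ofReal (Real.exp (K * (1 + 2 * K) * (4 * K ^ 2 * l + μ₁))) *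
    weightedNorm ω ∞ (K ^ 2 * (4 * K ^ 2 * l + μ₁)) g *
    weightedNorm ω ∞ (K ^ 2 * (4 * K ^ 2 * l + μ₁)) (fourierHat g) *
    weightedNorm ω 2 (-μ₁) (fun _ : PhaseSpace N => (1 : ℝ)) *
    weightedNorm ω (twoPConj p) (-μ₂) (fun _ : PhaseSpace N => (1 : ℝ)) ^ 2

/-- The factor in front of the infimum, at `τ = 1/2`. -/
noncomputable def spectrogramPrefactor (K : ℝ) (g : Space N → ℂ) (l : ℝ) : ℝ≥0∞ :=
  ENNReal.ofReal (Real.exp (K / 2 * (1 + 2 * K) * l) /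
      ((2 * Real.pi) ^ (5 / 2 * (N : ℝ)) * (1 / 2 - (1 / 2) ^ 2) ^ ((N : ℝ) / 2))) /
    eLpNorm g 2 volume ^ 4

theorem constWignerSpectrogram_eq (p : ℝ≥0∞) (g : Space N → ℂ) (l μ : ℝ) :
    constWignerSpectrogram ω K b p (1 / 2) g l μ = spectrogramPrefactor K g l *
      ⨅ (μ₁ : ℝ) (μ₂ : ℝ) (_ : 2 * (K ^ 2 * μ₁ + μ₂) = μ ∧ (N : ℝ) / b < μ₁ ∧
        2 * (N : ℝ) / (b * (twoPConj p).toReal) < μ₂), spectrogramTerm ω K p g l μ₁ μ₂ :=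
  rfl

theorem holderConjugate_twoPConj {p : ℝ≥0∞} (hp : 1 ≤ p) :
    (twoPConj p).HolderConjugate (2 * p) := by
  have h : 1 ≤ 2 * p := by
    calc (1 : ℝ≥0∞) = 1 * 1 := (one_mul 1).symm
      _ ≤ 2 * p := mul_le_mul' one_le_two hp
  have := ENNReal.HolderConjugate.conjExponent h
  rw [twoPConj]
  exact this.symm

theorem one_le_twoPConj (p : ℝ≥0∞) : 1 ≤ twoPConj p := by
  rw [twoPConj, ENNReal.conjExponent]
  exact le_self_add

/-- Doubling keeps the exponent above `1` even at `p = 1`, so `e^{-μ₂ω}` is never measured in `L^∞`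
and its threshold is a genuine division. -/
theorem twoPConj_ne_top {p : ℝ≥0∞} (hp : 1 ≤ p) : twoPConj p ≠ ∞ := by
  have h : (1 : ℝ≥0∞) < 2 * p := by
    calc (1 : ℝ≥0∞) < 2 * 1 := by norm_num
      _ ≤ 2 * p := by gcongr
  rw [twoPConj, ENNReal.conjExponent, ENNReal.add_ne_top]
  exact ⟨ENNReal.one_ne_top, ENNReal.inv_ne_top.2 (tsub_pos_of_lt h).ne'⟩

theorem toReal_twoPConj_pos {p : ℝ≥0∞} (hp : 1 ≤ p) : 0 < (twoPConj p).toReal :=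
  ENNReal.toReal_pos (zero_lt_one.trans_le (one_le_twoPConj p)).ne' (twoPConj_ne_top hp)

theorem eLpNorm_schwartz_ne_zero {g : 𝓢(Space N, ℂ)} (hg : g ≠ 0) :
    eLpNorm (g : Space N → ℂ) 2 volume ≠ 0 := by
  rw [Ne, eLpNorm_eq_zero_iff g.continuous.aestronglyMeasurable two_ne_zero]
  intro h
  refine hg (DFunLike.coe_injective ?_)
  exact (g.continuous.ae_eq_iff_eq volume continuous_zero).1 h

theorem eLpNorm_schwartz_ne_top (g : 𝓢(Space N, ℂ)) :
    eLpNorm (g : Space N → ℂ) 2 volume ≠ ∞ :=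
  (SchwartzMap.memLp g 2 volume).2.ne

theorem weightedNorm_wigner_le_spectrogramTerm (hω : IsWeightFunction ω K a b) {p : ℝ≥0∞}
    (hp : 1 ≤ p) {f : Space N → ℂ} (hf : f ∈ ultraSchwartz (Space N) ω) {g : 𝓢(Space N, ℂ)}
    (hg : g ≠ 0) {l : ℝ} (hl : 0 ≤ l) {μ₁ μ₂ : ℝ} (hμ₁ : 0 ≤ μ₁) :
    weightedNorm ω ∞ (K * l) (wigner f) ≤ spectrogramPrefactor K g l *
      (spectrogramTerm ω K p g l μ₁ μ₂ *
        weightedNorm ω p (8 * K ^ 5 * l + 2 * (K ^ 2 * μ₁ + μ₂)) (spectrogram g f)) := by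
  have hK := hω.one_le_K
  have hK0 := hω.K_pos
  have hf' := fourierInvertible_of_mem_ultraSchwartz hω hf
  have hg' := SchwartzMap.fourierInvertible g
  have hV := continuous_shortTimeFourier hg' hf'
  have hKl : 0 ≤ K * l := mul_nonneg hK0.le hl
  -- The weight on the supremum of the Rihaczek form: `4K²l ≥ 2Kl` from the Wigner bound, plus `μ₁`
  -- paid for passing from `L²` to `L^∞`.
  set M : ℝ := 4 * K ^ 2 * l + μ₁ with hM
  have hM0 : 0 ≤ M := by positivity
  set G : ℝ≥0∞ := ∫⁻ x, ‖g x‖ₑ ^ 2 with hG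
  have hG2 : eLpNorm (g : Space N → ℂ) 2 volume ^ 2 = G := eLpNorm_two_sq _
  have hG0 : G ≠ 0 := by
    rw [← hG2]
    exact pow_ne_zero 2 (eLpNorm_schwartz_ne_zero hg)
  have hGtop : G ≠ ∞ := by
    rw [← hG2]
    exact ENNReal.pow_ne_top (eLpNorm_schwartz_ne_top g)
  have h1 := weightedNorm_wigner_le_rihaczek hω hf hKl
  have h2 : weightedNorm ω 2 (2 * (K * l)) (rihaczek f) ≤
      weightedNorm ω 2 (-μ₁) (fun _ : PhaseSpace N => (1 : ℝ)) *
        weightedNorm ω ∞ M (rihaczek f) := by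
    refine (hω.weightedNorm_mono 2 (m := 4 * K ^ 2 * l) ?_ _).trans
      (hω.weightedNorm_le_mul 2 ∞ 2 μ₁ (4 * K ^ 2 * l)
        hf'.continuous_rihaczekForm.aestronglyMeasurable)
    nlinarith
  have h3 := weightedNorm_top_rihaczekForm_le hω hM0 hg' hf'
  have h4 : weightedNorm ω 1 (K ^ 2 * M) (shortTimeFourier g f) ^ 2 ≤
      weightedNorm ω (twoPConj p) (-μ₂) (fun _ : PhaseSpace N => (1 : ℝ)) ^ 2 *
        weightedNorm ω p (8 * K ^ 5 * l + 2 * (K ^ 2 * μ₁ + μ₂)) (spectrogram g f) := by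
    have := holderConjugate_twoPConj hp
    have h5 := hω.weightedNorm_le_mul (twoPConj p) (2 * p) 1 μ₂ (K ^ 2 * M)
      hV.aestronglyMeasurable
    refine (pow_le_pow_left₀ zero_le h5 2).trans ?_
    rw [mul_pow, weightedNorm_two_mul_sq]
    refine mul_le_mul_right (hω.weightedNorm_mono p ?_ _) _
    -- Squaring doubles `K²M + μ₂` to `8K⁴l + 2(K²μ₁ + μ₂)`, and `K⁴ ≤ K⁵` gives the stated
    -- exponent.
    have h6 : K ^ 4 * l ≤ K ^ 5 * l := by
      gcongr
      norm_num
    rw [hM]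
    nlinarith
  have hconst : ENNReal.ofReal ((4 / (2 * Real.pi)) ^ ((N : ℝ) / 2)) ≤
      spectrogramPrefactor K g l * (ENNReal.ofReal (fourierConst (Space N)) * G) ^ 2 := by
    have hE : 1 ≤ Real.exp (K / 2 * (1 + 2 * K) * l) := Real.one_le_exp (by positivity)
    have h7 := ENNReal.ofReal_le_ofReal (four_div_two_pi_rpow_le (N := N) hE)
    have h8 : fourierConst (Space N) = (2 * Real.pi) ^ N := by
      rw [fourierConst, finrank_euclideanSpace_fin]
    have h9 : eLpNorm (g : Space N → ℂ) 2 volume ^ 4 = G ^ 2 := by rw [← hG2, ← pow_mul]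
    rw [spectrogramPrefactor, h9, mul_pow, mul_comm (_ ^ 2) (G ^ 2), ← mul_assoc,
      ENNReal.div_mul_cancel (pow_ne_zero 2 hG0) (ENNReal.pow_ne_top hGtop), h8,
      ← ENNReal.ofReal_pow (by positivity)]
    refine h7.trans (le_of_eq (ENNReal.ofReal_mul' (by positivity)))
  calc weightedNorm ω ∞ (K * l) (wigner f)
      ≤ ENNReal.ofReal ((4 / (2 * Real.pi)) ^ ((N : ℝ) / 2)) *
        weightedNorm ω 2 (2 * (K * l)) (rihaczek f) := h1
    _ ≤ (spectrogramPrefactor K g l * (ENNReal.ofReal (fourierConst (Space N)) * G) ^ 2) *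
        (weightedNorm ω 2 (-μ₁) (fun _ : PhaseSpace N => (1 : ℝ)) *
          weightedNorm ω ∞ M (rihaczek f)) := mul_le_mul' hconst h2
    _ = spectrogramPrefactor K g l *
        (weightedNorm ω 2 (-μ₁) (fun _ : PhaseSpace N => (1 : ℝ)) *
          ((ENNReal.ofReal (fourierConst (Space N)) * G) ^ 2 *
            weightedNorm ω ∞ M (rihaczek f))) := by ring
    _ ≤ spectrogramPrefactor K g l *
        (weightedNorm ω 2 (-μ₁) (fun _ : PhaseSpace N => (1 : ℝ)) *
          (ENNReal.ofReal (Real.exp (K * (1 + 2 * K) * M)) * weightedNorm ω ∞ (K ^ 2 * M) g *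
            weightedNorm ω ∞ (K ^ 2 * M) (fourierHat g) *
            (weightedNorm ω (twoPConj p) (-μ₂) (fun _ : PhaseSpace N => (1 : ℝ)) ^ 2 *
            weightedNorm ω p (8 * K ^ 5 * l + 2 * (K ^ 2 * μ₁ + μ₂)) (spectrogram g f)))) := by
        refine mul_le_mul_right (mul_le_mul_right (h3.trans ?_) _) _
        exact mul_le_mul_right h4 _
    _ = _ := by
        rw [spectrogramTerm]
        ring

theorem weightedNorm_ne_zero {V : Type*} [NormedAddCommGroup V] [InnerProductSpace ℝ V]
    [FiniteDimensional ℝ V] [MeasurableSpace V] [BorelSpace V] {G : Type*} [NormedAddCommGroup G]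
    [NormedSpace ℝ G] (hω : IsWeightFunction ω K a b) {p : ℝ≥0∞} (hp : p ≠ 0) (l : ℝ) {F : V → G}
    (hc : Continuous F) {x : V} (hx : F x ≠ 0) : weightedNorm ω p l F ≠ 0 := by
  have hc' : Continuous fun x => Real.exp (l * ω ‖x‖) • F x := (hω.continuous_exp l).smul hc
  rw [weightedNorm, Ne, eLpNorm_eq_zero_iff hc'.aestronglyMeasurable hp]
  intro h
  have := congrFun ((hc'.ae_eq_iff_eq volume continuous_zero).1 h) x
  simp only [Pi.zero_apply, smul_eq_zero, Real.exp_ne_zero, false_or] at this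
  exact hx this

/-- With `0 · ∞ = 0`, an infinite spectrogram norm would make the estimate collapse if the infimum
vanished. Admissible `μ₁, μ₂` lie in `[0, μ/2]`, so monotonicity of the weights bounds every factor
below uniformly. -/
theorem exists_lower_bound_spectrogramTerm (hω : IsWeightFunction ω K a b) (p : ℝ≥0∞)
    {g : 𝓢(Space N, ℂ)} (hg : g ≠ 0) {l : ℝ} (hl : 0 ≤ l) (μ : ℝ) :
    ∃ c : ℝ≥0∞, c ≠ 0 ∧ ∀ μ₁ μ₂ : ℝ, 2 * (K ^ 2 * μ₁ + μ₂) = μ → (N : ℝ) / b < μ₁ →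
      2 * (N : ℝ) / (b * (twoPConj p).toReal) < μ₂ → c ≤ spectrogramTerm ω K p g l μ₁ μ₂ := by
  have hg' := SchwartzMap.fourierInvertible g
  have hK := hω.one_le_K
  have hK0 := hω.K_pos
  have hb := hω.b_pos
  obtain ⟨x, hx⟩ : ∃ x, g x ≠ 0 := by
    by_contra! h
    exact hg (DFunLike.ext _ _ h)
  obtain ⟨ξ, hξ⟩ : ∃ ξ, fourierHat (g : Space N → ℂ) ξ ≠ 0 := by
    by_contra! h
    have h1 := enorm_le_lintegral_fourierHat hg'.continuous hg'.integrable x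
    simp only [h, enorm_zero, lintegral_zero, nonpos_iff_eq_zero, mul_eq_zero,
      ENNReal.ofReal_eq_zero, not_le.2 (fourierConst_pos (Space N)), enorm_eq_zero, false_or] at h1
    exact hx h1
  have ht0 : twoPConj p ≠ 0 := (zero_lt_one.trans_le (one_le_twoPConj p)).ne'
  refine ⟨1 * weightedNorm ω ∞ 0 g * weightedNorm ω ∞ 0 (fourierHat g) *
    weightedNorm ω 2 (-(μ / 2)) (fun _ : PhaseSpace N => (1 : ℝ)) *
    weightedNorm ω (twoPConj p) (-(μ / 2)) (fun _ : PhaseSpace N => (1 : ℝ)) ^ 2, ?_, ?_⟩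
  · refine mul_ne_zero (mul_ne_zero (mul_ne_zero (mul_ne_zero one_ne_zero ?_) ?_) ?_)
      (pow_ne_zero 2 ?_)
    · exact weightedNorm_ne_zero hω ENNReal.top_ne_zero 0 hg'.continuous hx
    · exact weightedNorm_ne_zero hω ENNReal.top_ne_zero 0 hg'.continuous_hat hξ
    · exact weightedNorm_ne_zero hω two_ne_zero _ continuous_const (x := 0) one_ne_zero
    · exact weightedNorm_ne_zero hω ht0 _ continuous_const (x := 0) one_ne_zero
  · intro μ₁ μ₂ hμ h1 h2
    have hμ₁ : 0 ≤ μ₁ := le_trans (by positivity) h1.le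
    have hμ₂ : 0 ≤ μ₂ := le_trans (by positivity) h2.le
    have h3 : μ₁ ≤ K ^ 2 * μ₁ := le_mul_of_one_le_left hμ₁ (one_le_pow₀ hK)
    rw [spectrogramTerm]
    gcongr
    · rw [ENNReal.one_le_ofReal]
      exact Real.one_le_exp (by positivity)
    · exact hω.weightedNorm_mono _ (by positivity) _
    · exact hω.weightedNorm_mono _ (by positivity) _
    · exact hω.weightedNorm_mono _ (by linarith) _
    · exact hω.weightedNorm_mono _ (by nlinarith) _

theorem exists_admissible (hω : IsWeightFunction ω K a b) {p : ℝ≥0∞} {μ : ℝ}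
    (hμ : 2 * (N : ℝ) / b * (K ^ 2 + 2 / (twoPConj p).toReal) < μ) :
    ∃ μ₁ μ₂ : ℝ, 2 * (K ^ 2 * μ₁ + μ₂) = μ ∧ (N : ℝ) / b < μ₁ ∧
      2 * (N : ℝ) / (b * (twoPConj p).toReal) < μ₂ := by
  have hK0 := hω.K_pos
  set q := 2 * (N : ℝ) / (b * (twoPConj p).toReal) with hq
  have h1 : 2 * (N : ℝ) / b * (K ^ 2 + 2 / (twoPConj p).toReal) =
      2 * (K ^ 2 * ((N : ℝ) / b) + q) := by
    rw [hq, mul_add, div_mul_div_comm]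
    ring
  rw [h1] at hμ
  -- Half of the excess over the threshold goes to each parameter; the division by `K ^ 2`
  -- compensates the coefficient of `μ₁`.
  set δ := μ / 2 - (K ^ 2 * ((N : ℝ) / b) + q) with hδ
  have hδ0 : 0 < δ := by linarith
  refine ⟨(N : ℝ) / b + δ / (2 * K ^ 2), q + δ / 2, ?_, ?_, ?_⟩
  · have : K ^ 2 * (δ / (2 * K ^ 2)) = δ / 2 := by field_simp
    rw [mul_add (K ^ 2), this]
    linarith
  · have : 0 < δ / (2 * K ^ 2) := by positivity
    linarith
  · linarith

theorem spectrogramTerm_lt_top (hω : IsWeightFunction ω K a b) {p : ℝ≥0∞}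
    (hp : 1 ≤ p) {g : Space N → ℂ} (hg : g ∈ ultraSchwartz (Space N) ω) (l : ℝ)
    {μ₁ μ₂ : ℝ} (hμ₁ : (N : ℝ) / b < μ₁)
    (hμ₂ : 2 * (N : ℝ) / (b * (twoPConj p).toReal) < μ₂) :
    spectrogramTerm ω K p g l μ₁ μ₂ < ∞ := by
  have hb := hω.b_pos
  have ht := toReal_twoPConj_pos hp
  have h1 : 0 ≤ μ₁ := le_trans (by positivity) hμ₁.le
  have h2 : 0 ≤ μ₂ := le_trans (by positivity) hμ₂.le
  have hdim : (Module.finrank ℝ (PhaseSpace N) : ℝ) = 2 * N := by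
    rw [finrank_withLp_prod, finrank_euclideanSpace_fin]
    push_cast
    ring
  rw [div_lt_iff₀ (by positivity)] at hμ₁ hμ₂
  rw [spectrogramTerm]
  refine ENNReal.mul_lt_top (ENNReal.mul_lt_top (ENNReal.mul_lt_top (ENNReal.mul_lt_top
    ENNReal.ofReal_lt_top ?_) ?_) ?_) (ENNReal.pow_lt_top ?_)
  · exact weightedNorm_top_lt_top_of_rapidDecay (rapidDecay_of_mem_ultraSchwartz hω hg) _
  · exact weightedNorm_top_lt_top_of_rapidDecay
      (rapidDecay_fourierHat_of_mem_ultraSchwartz hω hg) _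
  · refine hω.weightedNorm_exp_neg_lt_top one_le_two ENNReal.ofNat_ne_top h1 ?_
    rw [hdim, ENNReal.toReal_ofNat]
    linarith
  · refine hω.weightedNorm_exp_neg_lt_top (one_le_twoPConj p) (twoPConj_ne_top hp) h2 ?_
    rw [hdim]
    linarith

theorem spectrogramPrefactor_lt_top {g : 𝓢(Space N, ℂ)} (hg : g ≠ 0) (l : ℝ) :
    spectrogramPrefactor K g l < ∞ :=
  ENNReal.div_lt_top ENNReal.ofReal_ne_top (pow_ne_zero 4 (eLpNorm_schwartz_ne_zero hg))

theorem spectrogramPrefactor_ne_zero (g : 𝓢(Space N, ℂ)) (l : ℝ) :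
    spectrogramPrefactor K g l ≠ 0 := by
  refine ENNReal.div_ne_zero.2 ⟨?_, ENNReal.pow_ne_top (eLpNorm_schwartz_ne_top g)⟩
  rw [Ne, ENNReal.ofReal_eq_zero, not_le]
  have h1 : (0 : ℝ) < 1 / 2 - (1 / 2) ^ 2 := by norm_num
  positivity

theorem constSpectrogram_lt_top (hω : IsWeightFunction ω K a b) {p : ℝ≥0∞} (hp : 1 ≤ p)
    {s : PhaseSpace N → ℂ} {g : 𝓢(Space N, ℂ)} (hg : g ≠ 0) {l : ℝ}
    (hs : weightedNorm ω 1 (K * l) s < ∞) {μ : ℝ}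
    (hμ : 2 * (N : ℝ) / b * (K ^ 2 + 2 / (twoPConj p).toReal) < μ)
    (hgω : (g : Space N → ℂ) ∈ ultraSchwartz (Space N) ω) :
    constSpectrogram ω K b p s g l μ < ∞ := by
  obtain ⟨μ₁, μ₂, h⟩ := exists_admissible hω hμ
  refine ENNReal.mul_lt_top (ENNReal.mul_lt_top ENNReal.ofReal_lt_top ?_) hs
  rw [constWignerSpectrogram_eq]
  refine ENNReal.mul_lt_top (spectrogramPrefactor_lt_top hg l) ?_
  exact (iInf_le_of_le μ₁ (iInf_le_of_le μ₂ (iInf_le _ h))).trans_lt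
    (spectrogramTerm_lt_top hω hp hgω l h.2.1 h.2.2)

theorem weightedNorm_wigner_le_constWignerSpectrogram (hω : IsWeightFunction ω K a b) {p : ℝ≥0∞}
    (hp : 1 ≤ p) {f : Space N → ℂ} (hf : f ∈ ultraSchwartz (Space N) ω) {g : 𝓢(Space N, ℂ)}
    (hg : g ≠ 0) {l : ℝ} (hl : 0 ≤ l) {μ : ℝ}
    (hμ : 2 * (N : ℝ) / b * (K ^ 2 + 2 / (twoPConj p).toReal) < μ) :
    weightedNorm ω ∞ (K * l) (wigner f) ≤ constWignerSpectrogram ω K b p (1 / 2) g l μ *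
      weightedNorm ω p (8 * K ^ 5 * l + μ) (spectrogram g f) := by
  have hb := hω.b_pos
  have hterm : ∀ μ₁ μ₂ : ℝ, 2 * (K ^ 2 * μ₁ + μ₂) = μ → (N : ℝ) / b < μ₁ →
      weightedNorm ω ∞ (K * l) (wigner f) ≤ spectrogramPrefactor K g l *
        (spectrogramTerm ω K p g l μ₁ μ₂ *
          weightedNorm ω p (8 * K ^ 5 * l + μ) (spectrogram g f)) := by
    rintro μ₁ μ₂ rfl h1
    exact weightedNorm_wigner_le_spectrogramTerm hω hp hf hg hl (le_trans (by positivity) h1.le)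
  rw [constWignerSpectrogram_eq, mul_assoc]
  set S := weightedNorm ω p (8 * K ^ 5 * l + μ) (spectrogram g f)
  set P := spectrogramPrefactor K (g : Space N → ℂ) l with hP
  have hP0 : P ≠ 0 := spectrogramPrefactor_ne_zero g l
  have hPtop : P ≠ ∞ := (spectrogramPrefactor_lt_top hg l).ne
  -- The infimum is reached by dividing by `P * S`, so the values `0` and `∞` of `S` are treated
  -- apart. For `S = 0`, a single admissible pair already forces the left side to vanish.
  rcases eq_or_ne S 0 with hS0 | hS0
  · obtain ⟨μ₁, μ₂, h⟩ := exists_admissible hω hμ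
    have := hterm μ₁ μ₂ h.1 h.2.1
    rw [hS0, mul_zero, mul_zero] at this
    exact this.trans zero_le
  rcases eq_or_ne S ∞ with hStop | hStop
  · obtain ⟨c, hc0, hc⟩ := exists_lower_bound_spectrogramTerm (N := N) hω p hg hl μ
    have hinf : ⨅ (μ₁ : ℝ) (μ₂ : ℝ) (_ : 2 * (K ^ 2 * μ₁ + μ₂) = μ ∧ (N : ℝ) / b < μ₁ ∧
        2 * (N : ℝ) / (b * (twoPConj p).toReal) < μ₂), spectrogramTerm ω K p g l μ₁ μ₂ ≠ 0 := by
      refine fun h0 => hc0 (le_antisymm (h0 ▸ ?_) zero_le)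
      exact le_iInf fun μ₁ => le_iInf fun μ₂ => le_iInf fun h => hc μ₁ μ₂ h.1 h.2.1 h.2.2
    rw [hStop, ENNReal.mul_top hinf, ENNReal.mul_top hP0]
    exact le_top
  · have hPS0 : P * S ≠ 0 := mul_ne_zero hP0 hS0
    have hPStop : P * S ≠ ∞ := ENNReal.mul_ne_top hPtop hStop
    rw [mul_left_comm, ← ENNReal.div_le_iff hPS0 hPStop]
    refine le_iInf fun μ₁ => le_iInf fun μ₂ => le_iInf fun h => ?_
    rw [ENNReal.div_le_iff hPS0 hPStop, mul_left_comm]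
    exact hterm μ₁ μ₂ h.1 h.2.1

theorem weightedNorm_cohen_le_spectrogram (hω : IsWeightFunction ω K a b) {p : ℝ≥0∞} (hp : 1 ≤ p)
    {σ : UltraDistribution (PhaseSpace N) ω} {s : PhaseSpace N → ℂ} (hs : σ.IsFunction s)
    {f : Space N → ℂ} (hf : f ∈ ultraSchwartz (Space N) ω) {g : 𝓢(Space N, ℂ)}
    (hg : g ≠ 0) {l : ℝ} (hl : 0 ≤ l) {μ : ℝ}
    (hμ : 2 * (N : ℝ) / b * (K ^ 2 + 2 / (twoPConj p).toReal) < μ) :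
    weightedNorm ω ∞ l (cohen σ f) ≤ constSpectrogram ω K b p s g l μ *
      weightedNorm ω p (8 * K ^ 5 * l + μ) (spectrogram g f) := by
  refine (weightedNorm_cohen_le hω ∞ 1 hs hf hl).trans ?_
  refine (mul_le_mul_right
    (weightedNorm_wigner_le_constWignerSpectrogram hω hp hf hg hl hμ) _).trans (le_of_eq ?_)
  rw [constWigner, constSpectrogram]
  ring

end Spectrogram

theorem mainTheorem6 (N : ℕ) (hN : 0 < N) (ω : ℝ → ℝ) (K a b : ℝ) (hω : IsWeightFunction ω K a b)
    (p p' : ℝ≥0∞) (hp : 1 ≤ p) (hp' : p' = ENNReal.conjExponent p) :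
    -- (i)
    (∀ (σ : UltraDistribution (PhaseSpace N) ω) (s : PhaseSpace N → ℂ), σ.IsFunction s →
      (∀ ν : ℝ, 0 ≤ ν → weightedNorm ω p' ν s < ∞) →
      ∀ l : ℝ, 0 ≤ l → ∀ f ∈ ultraSchwartz (Space N) ω,
        weightedNorm ω ∞ l (cohen σ f) ≤
          constWigner ω K p' s l * weightedNorm ω p (K * l) (wigner f)) ∧
    -- (ii)
    (∀ (σ : UltraDistribution (PhaseSpace N) ω) (s : PhaseSpace N → ℂ), σ.IsFunction s →
      (∀ ν : ℝ, 0 ≤ ν → weightedNorm ω 1 ν s < ∞) →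
      ∀ l : ℝ, 0 ≤ l → ∀ f ∈ ultraSchwartz (Space N) ω,
        weightedNorm ω ∞ l (cohen σ f) ^ 2 ≤
          constRihaczek ω K s l * (weightedNorm ω p (4 * K ^ 3 * l) (rihaczek f) *
            weightedNorm ω p' (4 * K ^ 3 * l) (rihaczek f))) ∧
    -- (iii)
    (∀ (σ : UltraDistribution (PhaseSpace N) ω) (s : PhaseSpace N → ℂ), σ.IsFunction s →
      (∀ ν : ℝ, 0 ≤ ν → weightedNorm ω 1 ν s < ∞) →
      ∀ g : 𝓢(Space N, ℂ), g ≠ 0 → ∀ l : ℝ, 0 ≤ l →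
      ∀ μ : ℝ, 2 * (N : ℝ) / b * (K ^ 2 + 2 / (twoPConj p).toReal) < μ →
        ((g : Space N → ℂ) ∈ ultraSchwartz (Space N) ω → constSpectrogram ω K b p s g l μ < ∞) ∧
        ∀ f ∈ ultraSchwartz (Space N) ω,
          weightedNorm ω ∞ l (cohen σ f) ≤
            constSpectrogram ω K b p s g l μ *
              weightedNorm ω p (8 * K ^ 5 * l + μ) (spectrogram g f)) := by
  subst hp'
  have hconj : p.HolderConjugate (ENNReal.conjExponent p) :=
    ENNReal.HolderConjugate.conjExponent hp
  have hconj' : (ENNReal.conjExponent p).HolderConjugate p := hconj.symm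
  refine ⟨fun σ s hs _ l hl f hf => ?_, fun σ s hs _ l hl f hf => ?_,
    fun σ s hs hs1 g hg l hl μ hμ => ⟨fun hgω => ?_, fun f hf => ?_⟩⟩
  · exact weightedNorm_cohen_le hω p _ hs hf hl
  · exact weightedNorm_cohen_sq_le hω p _ hs hf hl
  · exact constSpectrogram_lt_top hω hp hg (hs1 _ (mul_nonneg hω.K_pos.le hl)) hμ hgω
  · exact weightedNorm_cohen_le_spectrogram hω hp hs hf hg hl hμ
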